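/- Let $C$ be a quasi-category, $c \in C_0$ a vertex and $n \ge 2$. Let $C^e$ be the stratified simplicial set with underlying simplicial set $C$ whose thin simplices are all degenerate simplices, all simplices of dimension $\ge 2$, and the $1$-simplices that are equivalences (those $f : a \to b$ for which there are a $1$-simplex $g : b \to a$ and $2$-simplices exhibiting the degenerate edges at $a$ and $b$ as composites $g \circ f$ and $f \circ g$). Then $C^e$ is a weak complicial set, and $\tau_n(C^e, c)$ is a group. Explicitly, the following holds. Here a stratified simplicial set is a simplicial set with a set of thin simplices containing all degenerate ones and no vertex; stratified maps preserve thinness; $\Delta[n]$ and $\partial\Delta[n]$ have only degenerate simplices thin; in $\Delta[1]_t$ the nondegenerate $1$-simplex is thin as well; $(x,y)$ is thin in $X \circledast Y$ iff $x$ and $y$ are thin; in $\Delta^k[m]$ (underlying simplicial set $\Delta[m]$, $m\ge 1$, $0\le k\le m$) the thin simplices are the degenerate ones and those whose image contains $\{k-1,k,k+1\}\cap[m]$; $\Lambda^k[m] \subset \Delta^k[m]$ is the $k$-th horn with the induced thin simplices. A weak complicial set is a stratified simplicial set with the right lifting property against $\Lambda^k[m] \hookrightarrow \Delta^k[m]$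 ($m \ge 1$) and $\Delta^k[m]' \hookrightarrow \Delta^k[m]''$ ($m \ge 2$), $0\le k\le m$, where $\Delta^k[m]'$ (resp. $\Delta^k[m]''$) is obtained from $\Delta^k[m]$ by making all $(m-1)$-simplices of the horn (resp. of $\Delta[m]$) thin. Let $S$ be the set of $n$-simplices $\alpha : \Delta[n] \to C^e$ that are constant at $c$ on $\partial\Delta[n]$. For $\alpha,\beta\in S$ write $\alpha\sim\beta$ if there is a stratified map $H : \Delta[n] \circledast \Delta[1]_t \to C^e$ from $\alpha$ to $\beta$ that is constant at $c$ on $\partial\Delta[n]\circledast\Delta[1]_t$. Then $\sim$ is an equivalence relation on $S$; put $\tau_n(C^e,c) = S/{\sim}$. For all $\alpha,\beta\in S$ there is a stratified map $\theta : \Delta^n[n+1] \to C^e$ with $d_{n-1}\theta=\alpha$, $d_{n+1}\theta=\beta$, $d_i\theta$ constant at $c$ for $i<n-1$, and $d_n\theta\in S$. The rule $[\alpha][\beta]=[d_n\theta]$ (for any such $\theta$) is a well-defined multiplication on $\tau_n(C^e,c)$ which makes it a group, with unit the class of the constant simplex at $c$. -/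

import Mathlib

open CategoryTheory Simplicial MonoidalCategory CartesianMonoidalCategory

universe u

/-- A stratified simplicial set: a simplicial set with a set of thin simplices that contains
all degenerate simplices and no vertex. -/
structure StratifiedSSet where
  /-- the underlying simplicial set -/
  sset : SSet.{u}
  /-- the thin simplices of each dimension -/
  thin : ∀ m : ℕ, Set (sset _⦋m⦌)
  degenerate_subset_thin : ∀ m, sset.degenerate m ⊆ thin m
  thin_zero : thin 0 = ∅

namespace StratifiedSSet

/-- A simplicial map is stratified if it carries thin simplices to thin simplices. -/
def IsStratified (X Y : StratifiedSSet.{u}) (f : X.sset ⟶ Y.sset) : Prop :=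
  ∀ (m : ℕ) (s : X.sset _⦋m⦌), s ∈ X.thin m → f.app _ s ∈ Y.thin m

/-- Stratified maps. -/
structure Hom (X Y : StratifiedSSet.{u}) where
  /-- the underlying simplicial map -/
  map : X.sset ⟶ Y.sset
  isStratified : IsStratified X Y map

/-- `X` has the right lifting property with respect to the stratified map `i : A → B`: every
stratified map `A → X` extends along `i` to a stratified map `B → X`. -/
def HasExtensionAlong (X : StratifiedSSet.{u}) {A B : StratifiedSSet.{u}} (i : Hom A B) : Prop :=
  ∀ f : Hom A X, ∃ g : Hom B X, i.map ≫ g.map = f.map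

/-- The minimal stratification of a simplicial set: only degenerate simplices are thin. -/
def minimal (K : SSet.{u}) : StratifiedSSet.{u} where
  sset := K
  thin m := K.degenerate m
  degenerate_subset_thin _ := subset_rfl
  thin_zero := K.degenerate_zero

/-- A simplicial map out of `K` is a stratified map out of `K` with its minimal stratification. -/
def homOfMinimal {K : SSet.{u}} {X : StratifiedSSet.{u}} (f : K ⟶ X.sset) :
    Hom (minimal K) X where
  map := f
  isStratified m _ hs := X.degenerate_subset_thin m (SSet.degenerate_app_apply hs f)

/-- The regular stratified subset of `X` on the subcomplex `A`: a simplex of `A` is thin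
iff it is thin in `X`. -/
def regular (X : StratifiedSSet.{u}) (A : X.sset.Subcomplex) : StratifiedSSet.{u} where
  sset := A
  thin m := {s | (s : X.sset _⦋m⦌) ∈ X.thin m}
  degenerate_subset_thin m _ hs := X.degenerate_subset_thin m (SSet.degenerate_app_apply hs A.ι)
  thin_zero := by
    ext s
    simp [X.thin_zero]

/-- The inclusion of a regular stratified subset. -/
def regularι (X : StratifiedSSet.{u}) (A : X.sset.Subcomplex) : Hom (X.regular A) X where
  map := A.ι
  isStratified _ _ hs := hs

/-- The cartesian product `X ⊛ Y`: a simplex `(x, y)` is thin iff `x` and `y` are thin. -/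
noncomputable def prod (X Y : StratifiedSSet.{u}) : StratifiedSSet.{u} where
  sset := X.sset ⊗ Y.sset
  thin m := {s | (fst X.sset Y.sset).app _ s ∈ X.thin m ∧ (snd X.sset Y.sset).app _ s ∈ Y.thin m}
  degenerate_subset_thin m _ hs :=
    ⟨X.degenerate_subset_thin m (SSet.degenerate_app_apply hs (fst X.sset Y.sset)),
      Y.degenerate_subset_thin m (SSet.degenerate_app_apply hs (snd X.sset Y.sset))⟩
  thin_zero := by
    refine Set.eq_empty_of_forall_notMem fun s hs => ?_
    have h := hs.1
    rw [X.thin_zero] at h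
    exact h

/-- The standard thin `n`-simplex `Δ[n]_t`: besides the degenerate simplices, the simplex
`id : [n] → [n]` is thin if `n ≠ 0`. -/
def thinSimplex (n : ℕ) : StratifiedSSet.{u} where
  sset := Δ[n]
  thin m := (Δ[n] : SSet.{u}).degenerate m ∪
    {s | n ≠ 0 ∧ ∃ h : m = n, SSet.stdSimplex.objEquiv s = eqToHom (by rw [h])}
  degenerate_subset_thin _ := Set.subset_union_left
  thin_zero := by
    ext s
    simp only [SSet.degenerate_zero, Set.empty_union, Set.mem_ofPred_eq, Set.mem_empty_iff_false,
      iff_false]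
    rintro ⟨hn, h, -⟩
    exact hn h.symm

/-- The vertices of `Δ[n]` lying in `{k - 1, k, k + 1}`. -/
def nbhd {n : ℕ} (k : Fin (n + 1)) : Set (Fin (n + 1)) :=
  {i | i.val + 1 = k.val ∨ i = k ∨ i.val = k.val + 1}

lemma not_nbhd_subset_range {n : ℕ} (k : Fin (n + 2)) (s : Fin 1 → Fin (n + 2)) :
    ¬ nbhd k ⊆ Set.range s := by
  intro h
  have key : ∀ i ∈ nbhd k, i = s 0 := by
    intro i hi
    obtain ⟨a, rfl⟩ := h hi
    rw [Subsingleton.elim a 0]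
  have hk : k = s 0 := key k (Or.inr (Or.inl rfl))
  by_cases h0 : k.val = 0
  · have h1 := key ⟨1, by omega⟩ (Or.inr (Or.inr (by simp [h0])))
    have := congrArg Fin.val (h1.trans hk.symm)
    simp at this
    omega
  · have h1 := key ⟨k.val - 1, by omega⟩ (Or.inl (by simp; omega))
    have := congrArg Fin.val (h1.trans hk.symm)
    simp at this
    omega

/-- The `k`-complicial simplex `Δ^k[n + 1]`: besides the degenerate simplices, those simplices
are thin whose image contains `{k - 1, k, k + 1} ∩ [n + 1]`. -/
def complicialSimplex (n : ℕ) (k : Fin (n + 2)) : StratifiedSSet.{u} where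
  sset := Δ[n + 1]
  thin m := (Δ[n + 1] : SSet.{u}).degenerate m ∪
    {s | nbhd k ⊆ Set.range (SSet.stdSimplex.asOrderHom s)}
  degenerate_subset_thin _ := Set.subset_union_left
  thin_zero := by
    ext s
    simp only [SSet.degenerate_zero, Set.empty_union, Set.mem_ofPred_eq, Set.mem_empty_iff_false,
      iff_false]
    exact not_nbhd_subset_range k _

/-- The inclusion `Λ^k[n + 1] → Δ^k[n + 1]` of the `k`-complicial horn. -/
def complicialHornι (n : ℕ) (k : Fin (n + 2)) :
    Hom ((complicialSimplex.{u} n k).regular (SSet.horn (n + 1) k)) (complicialSimplex.{u} n k) :=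
  regularι _ _

/-- `Δ^k[n + 2]'`: in addition to the thin simplices of `Δ^k[n + 2]`, all `(n + 1)`-simplices
of the horn are thin. -/
def complicialSimplex' (n : ℕ) (k : Fin (n + 3)) : StratifiedSSet.{u} where
  sset := Δ[n + 2]
  thin m := (complicialSimplex.{u} (n + 1) k).thin m ∪
    {s | m = n + 1 ∧ s ∈ (SSet.horn.{u} (n + 2) k).obj _}
  degenerate_subset_thin m := ((complicialSimplex.{u} (n + 1) k).degenerate_subset_thin m).trans
    Set.subset_union_left
  thin_zero := by
    refine Set.eq_empty_of_forall_notMem fun s hs => ?_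
    rcases hs with h | h
    · rw [(complicialSimplex.{u} (n + 1) k).thin_zero] at h
      exact h
    · exact absurd h.1 (by omega)

/-- `Δ^k[n + 2]''`: in addition to the thin simplices of `Δ^k[n + 2]`, all `(n + 1)`-simplices
are thin. -/
def complicialSimplex'' (n : ℕ) (k : Fin (n + 3)) : StratifiedSSet.{u} where
  sset := Δ[n + 2]
  thin m := (complicialSimplex.{u} (n + 1) k).thin m ∪ {_s | m = n + 1}
  degenerate_subset_thin m := ((complicialSimplex.{u} (n + 1) k).degenerate_subset_thin m).trans
    Set.subset_union_left
  thin_zero := by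
    refine Set.eq_empty_of_forall_notMem fun s hs => ?_
    rcases hs with h | h
    · rw [(complicialSimplex.{u} (n + 1) k).thin_zero] at h
      exact h
    · exact absurd (show 0 = n + 1 from h) (by omega)

/-- The inclusion `Δ^k[n + 2]' → Δ^k[n + 2]''`. -/
def complicialThinι (n : ℕ) (k : Fin (n + 3)) :
    Hom (complicialSimplex'.{u} n k) (complicialSimplex''.{u} n k) where
  map := 𝟙 _
  isStratified _ _ hs := hs.imp id And.left

/-- Weak complicial sets. -/
structure IsWeakComplicial (X : StratifiedSSet.{u}) : Prop where
  horn : ∀ (n : ℕ) (k : Fin (n + 2)), X.HasExtensionAlong (complicialHornι.{u} n k)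
  thin : ∀ (n : ℕ) (k : Fin (n + 3)), X.HasExtensionAlong (complicialThinι.{u} n k)

/-- Homotopy of stratified maps `f, g : A → X` relative to `B ⊆ A`, given by a stratified map
`A ⊛ Δ[1]_t → X` from `f` to `g` that is constant on `B`. -/
def HomotopicRel {A X : StratifiedSSet.{u}} (B : A.sset.Subcomplex) (f g : Hom A X) : Prop :=
  ∃ H : Hom (A.prod (thinSimplex.{u} 1)) X,
    SSet.ι₀ ≫ H.map = f.map ∧ SSet.ι₁ ≫ H.map = g.map ∧
      B.ι ▷ Δ[1] ≫ H.map = fst _ _ ≫ B.ι ≫ f.map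

variable (X : StratifiedSSet.{u}) (n : ℕ) (x : X.sset _⦋0⦌)

/-- The `n`-simplices of `X` whose restriction to `∂Δ[n]` is constant at the vertex `x`. -/
structure Sphere where
  /-- the simplex, as a map out of `Δ[n]` -/
  map : Δ[n] ⟶ X.sset
  boundary : (SSet.boundary n).ι ≫ map = SSet.const x

namespace Sphere

variable {X n x}

/-- The constant `n`-simplex at `x`. -/
def const : Sphere X n x where
  map := SSet.const x
  boundary := rfl

/-- The relation `∼_{∂Δ[n]}`. -/
def Rel (α β : Sphere X n x) : Prop :=
  HomotopicRel (A := minimal Δ[n]) (SSet.boundary n) (homOfMinimal α.map) (homOfMinimal β.map)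

/-- There is a stratified map `θ : Δ^n[n + 1] → X` whose faces are `α` in position `n - 1`,
`β` in position `n + 1`, the constants at `x` in positions `< n - 1`, and `d_n θ = γ`. -/
def IsProduct (α β γ : Sphere X n x) : Prop :=
  ∃ θ : Hom (complicialSimplex.{u} n (Fin.last n).castSucc) X,
    ∀ j : Fin (n + 2),
      (j.val + 1 < n → SSet.stdSimplex.δ j ≫ θ.map = SSet.const x) ∧
      (j.val + 1 = n → SSet.stdSimplex.δ j ≫ θ.map = α.map) ∧
      (j.val = n → SSet.stdSimplex.δ j ≫ θ.map = γ.map) ∧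
      (j.val = n + 1 → SSet.stdSimplex.δ j ≫ θ.map = β.map)

end Sphere

/-- The set underlying the homotopy monoid `τ_n(X, x)`. -/
def HomotopyMonoid : Type u := Quot (Sphere.Rel (X := X) (n := n) (x := x))

variable {X n x}

/-- The class in `τ_n(X, x)`. -/
def Sphere.cls (α : Sphere X n x) : HomotopyMonoid X n x := Quot.mk _ α

/-- The monoid structure `M` on `τ_n(X, x)` is the one with `[α][β] = [d_n θ]` for all `α`, `β`
and `θ` as in `Sphere.IsProduct`, and with the class of the constant simplex as unit. -/
structure IsHomotopyMonoidStructure (M : Monoid (HomotopyMonoid X n x)) : Prop where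
  mul_cls : ∀ α β γ : Sphere X n x, Sphere.IsProduct α β γ → M.mul α.cls β.cls = γ.cls
  one_eq : M.one = (Sphere.const : Sphere X n x).cls

end StratifiedSSet

/-- A `1`-simplex of a quasi-category is an equivalence if it has a two-sided inverse up to
`2`-simplices. -/
def SSet.IsEquivalenceEdge (C : SSet.{u}) (s : C _⦋1⦌) : Prop :=
  Nonempty (SSet.Edge.mk' s).InvStruct

/-- The stratified simplicial set `C^e` : thin are the degenerate simplices, all simplices of
dimension at least `2`, and the `1`-simplices that are equivalences. -/
def SSet.equivStratified (C : SSet.{u}) : StratifiedSSet.{u} where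
  sset := C
  thin
    | 0 => ∅
    | 1 => C.degenerate 1 ∪ {s | C.IsEquivalenceEdge s}
    | _ + 2 => Set.univ
  degenerate_subset_thin m := by
    match m with
    | 0 => simp
    | 1 => exact Set.subset_union_left
    | _ + 2 => exact Set.subset_univ _
  thin_zero := rfl

/-! Fillers in $C^e$. Thinness in $C^e$ only restricts edges, and for $m \ge 2$ the complicial
condition on $\Lambda^k[m]$ forces a nondegenerate edge to be thin only if $k$ is $0$ or $m$. So the
point is Joyal's extension theorem, `Quasicategory.exists_extension_horn_zero`. An equivalence $f :
a \to b$ fits into a $3$-simplex on $a, b, a, b$ whose faces $d_1$ and $d_2$ are degeneracies of $f$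
(`Edge.InvStruct.exists_threeSimplex`). This $3$-simplex and the given outer horn glue to a map on a
subcomplex of $\Delta[q+4]$. Attaching simplices along inner horns only
(`Quasicategory.exists_extension_of_toggle`) extends it to a subcomplex that contains a copy of
$\Delta[q+2]$, and the restriction to that copy fills the horn. The other outer horn follows by
passing to the opposite. The thinness extensions amount to 2-out-of-3 for equivalences, which comes
from the homotopy category.

The group. As $n \ge 2$, a simplex with constant boundary has only constant edges. Horns built from
such simplices therefore fill in all positions, as in a Kan complex. Let `Tri p a b c'` mean that
some simplex has faces $a, b, c'$ in positions $p, p+1, p+2$ and constant faces elsewhere; read it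
as $b = a c'$. Filling one dimension higher shows that of four such relations forming a tetrahedron,
any three imply the fourth (`SphereSimplex.isCompositionRelation_tri`). Together with units and
solvability this formally yields the equivalence relation, well-definedness, associativity and
inverses (`IsCompositionRelation.exists_group`). The product is `Tri` at $p = n - 1$. Homotopy
relative to the boundary is `Tri` with $c'$ constant: one direction triangulates the prism, the
other collapses the prism onto a simplex (`StratifiedSSet.Sphere.rel_iff`). -/

namespace SSet

open Opposite

/-! ### Horns as compatible families of faces -/

/-- The compatibility of a family of `(n + 1)`-simplices indexed by the faces of the horn
`Λ[n + 2, i]` (the value at `i` is irrelevant). -/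
def IsHornFamily (C : SSet.{u}) {n : ℕ} (i : Fin (n + 3)) (y : Fin (n + 3) → C _⦋n + 1⦌) : Prop :=
  ∀ (j k : Fin (n + 3)) (_ : j ≠ i) (_ : k ≠ i) (hjk : j < k),
    C.δ (k.pred (Fin.ne_zero_of_lt hjk)) (y j) = C.δ (j.castPred (Fin.ne_last_of_lt hjk)) (y k)

lemma IsHornFamily.exists_map {C : SSet.{u}} {n : ℕ} {i : Fin (n + 3)}
    {y : Fin (n + 3) → C _⦋n + 1⦌} (hy : C.IsHornFamily i y) :
    ∃ f : (Λ[n + 2, i] : SSet.{u}) ⟶ C, ∀ j (hj : j ≠ i), f.app _ (horn.face i j hj) = y j := by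
  have hc : horn.IsCompatible (i := i) (fun j _ ↦ yonedaEquiv.symm (y j)) := by
    intro j k hj hk hjk
    rw [stdSimplex.δ_comp_yonedaEquiv_symm, stdSimplex.δ_comp_yonedaEquiv_symm, hy j k hj hk hjk]
  obtain ⟨φ, hφ⟩ := hc.exists_desc
  refine ⟨φ, fun j hj ↦ ?_⟩
  rw [← horn.yonedaEquiv_ι, ← yonedaEquiv_comp, hφ j hj, Equiv.apply_symm_apply]

/-- In a quasi-category, a compatible family of faces of an inner horn has a filler. -/
lemma Quasicategory.exists_filler {C : SSet.{u}} [C.Quasicategory] {n : ℕ} (i : Fin (n + 3))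
    (h0 : 0 < i) (hn : i < Fin.last (n + 2)) (y : Fin (n + 3) → C _⦋n + 1⦌)
    (hy : C.IsHornFamily i y) : ∃ z : C _⦋n + 2⦌, ∀ j, j ≠ i → C.δ j z = y j := by
  obtain ⟨φ, hφ⟩ := hy.exists_map
  obtain ⟨g, rfl⟩ := Quasicategory.hornFilling h0 hn φ
  refine ⟨yonedaEquiv g, fun j hj ↦ ?_⟩
  rw [← hφ j hj, ← horn.yonedaEquiv_ι, ← yonedaEquiv_comp, horn.ι_ι_assoc,
    stdSimplex.yonedaEquiv_δ_comp]

/-! ### Extending maps between subcomplexes of $\Delta[N]$ along inner horns -/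

section

open _root_.SSet.stdSimplex

/-- A nonempty face is generated by one simplex, and a simplex of a union lies in one of the two
pieces. -/
lemma face_le_sup_iff {N : ℕ} (S : Finset (Fin (N + 1))) (A B : (Δ[N] : SSet.{u}).Subcomplex) :
    face S ≤ A ⊔ B ↔ face S ≤ A ∨ face S ≤ B := by
  obtain rfl | hS := S.eq_empty_or_nonempty
  · simp
  · obtain ⟨m, hm⟩ : ∃ m, S.card = m + 1 := ⟨S.card - 1, by have := hS.card_pos; omega⟩
    rw [face_eq_ofSimplex S m (S.orderIsoOfFin hm)]
    simp only [Subcomplex.ofSimplex_le_iff]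
    rfl

/-- If a subcomplex `A` of `Δ[N]` can be filled in one step by attaching the simplex spanned by
`insert k S` along the `k`-th inner horn, maps into quasi-categories extend. -/
lemma Quasicategory.exists_extension_sup_face {C : SSet.{u}} [C.Quasicategory] {N : ℕ}
    (A : (Δ[N] : SSet.{u}).Subcomplex) (k : Fin (N + 1)) (S : Finset (Fin (N + 1)))
    (hkS : k ∈ S) (hlt : ∃ i ∈ S, i < k) (hgt : ∃ i ∈ S, k < i)
    (hS : ¬ face (S.erase k) ≤ A) (hA : ∀ j ∈ S, j ≠ k → face (S.erase j) ≤ A)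
    (f : (A : SSet.{u}) ⟶ C) :
    ∃ g : ((A ⊔ face S : (Δ[N] : SSet.{u}).Subcomplex) : SSet.{u}) ⟶ C,
      Subcomplex.homOfLE le_sup_left ≫ g = f := by
  obtain ⟨m, hm⟩ : ∃ m, S.card = m + 1 := ⟨S.card - 1, by
    have := Finset.card_pos.2 ⟨k, hkS⟩; omega⟩
  obtain ⟨i₀, hi₀, hlt⟩ := hlt
  obtain ⟨i₁, hi₁, hgt⟩ := hgt
  let e : Fin (m + 1) ≃o S := S.orderIsoOfFin hm
  obtain ⟨E, hE⟩ : ∃ E : Δ[m] ≅ (face S : SSet.{u}), ∀ {d : ℕ} (x : Δ[m] _⦋d⦌) (j : Fin (d + 1)),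
      ((E.hom.app _ x).1 : Δ[N] _⦋d⦌) j = e (x j) :=
    ⟨isoOfRepresentableBy (faceRepresentableBy S m e), fun x j ↦ rfl⟩
  clear_value e
  obtain _ | m := m
  · have h1 := e.symm.injective (a₁ := ⟨i₀, hi₀⟩) (a₂ := ⟨i₁, hi₁⟩)
      (Subsingleton.elim (α := Fin 1) _ _)
    simp only [Subtype.mk.injEq] at h1
    exact absurd (hlt.trans hgt) (by rw [h1]; exact lt_irrefl _)
  let k' : Fin (m + 2) := e.symm ⟨k, hkS⟩
  have hk' : e k' = ⟨k, hkS⟩ := e.apply_symm_apply _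
  have h0 : 0 < k' := lt_of_le_of_lt (Fin.zero_le _)
    (e.symm.strictMono (a := ⟨i₀, hi₀⟩) (b := ⟨k, hkS⟩) hlt)
  have hn : k' < Fin.last _ := lt_of_lt_of_le
    (e.symm.strictMono (a := ⟨k, hkS⟩) (b := ⟨i₁, hi₁⟩) hgt) (Fin.le_last _)
  obtain ⟨p, hp⟩ : ∃ p : Δ[m + 1] ⟶ Δ[N], p = E.hom ≫ (face S).ι := ⟨_, rfl⟩
  have hpa : ∀ {d : ℕ} (x : Δ[m + 1] _⦋d⦌) (j : Fin (d + 1)),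
      (p.app _ x : Δ[N] _⦋d⦌) j = e (x j) := fun x j ↦ by
    rw [hp]; exact hE x j
  have hsurj : ∀ {d : ℕ} (x : Δ[N] _⦋d⦌) (hx : x ∈ (face S).obj _),
      p.app _ (E.inv.app _ ⟨x, hx⟩) = x := fun {d} x hx ↦ by
    rw [hp]
    exact congrArg Subtype.val (ConcreteCategory.congr_hom (congr_app E.inv_hom_id _) ⟨x, hx⟩)
  -- Of the maximal proper faces of the simplex on `S`, exactly the one opposite `k` is missing from
  -- `A`.
  have key : A.preimage p = Λ[m + 1, k'] := by
    apply le_antisymm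
    · rw [subcomplex_le_horn_iff]
      intro h
      apply hS
      rintro ⟨d⟩ x hx
      induction d using SimplexCategory.rec with | _ d
      rw [mem_face_iff] at hx
      have hx' : x ∈ (face S).obj _ := by
        rw [mem_face_iff]; exact fun i ↦ Finset.mem_of_mem_erase (hx i)
      obtain ⟨y, hy⟩ : ∃ y : Δ[m + 1] _⦋d⦌, p.app _ y = x := ⟨_, hsurj x hx'⟩
      have hya : y ∈ (face {k'}ᶜ).obj (op ⦋d⦌) := by
        rw [mem_face_iff]
        intro i
        rw [Finset.mem_compl, Finset.mem_singleton]
        intro hi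
        have h2 := hpa y i
        rw [hi, hk', hy] at h2
        exact (Finset.ne_of_mem_erase (hx i)) h2
      have h3 : p.app _ y ∈ A.obj _ := h _ hya
      rwa [hy] at h3
    · rintro ⟨d⟩ x hx
      induction d using SimplexCategory.rec with | _ d
      rw [mem_horn_iff_notMem_range] at hx
      obtain ⟨j, hj, hx⟩ := hx
      refine hA (e j) (e j).2 (fun h ↦ hj (e.injective (by rw [hk']; exact Subtype.ext h))) _ ?_
      rw [mem_face_iff]
      intro i
      rw [hpa]
      refine Finset.mem_erase.2 ⟨fun h ↦ hx ⟨i, ?_⟩, (e _).2⟩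
      exact e.injective (Subtype.ext h)
  let q : (Λ[m + 1, k'] : SSet.{u}) ⟶ (A : SSet.{u}) :=
    Subcomplex.lift (Λ[m + 1, k'].ι ≫ p) (by
      rw [← Subcomplex.image_eq_range, Subcomplex.image_le_iff, key])
  obtain ⟨σ, hσ⟩ := Quasicategory.hornFilling h0 hn (q ≫ f)
  -- The union is a pushout, so it suffices to extend over `face S`, where the horn filler does it.
  have sq : Subcomplex.BicartSq (A ⊓ face S) A (face S) (A ⊔ face S) := ⟨rfl, rfl⟩
  refine ⟨sq.isPushout.desc f (E.inv ≫ σ) ?_, sq.isPushout.inl_desc _ _ _⟩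
  ext ⟨d⟩ ⟨x, hxA, hxS⟩
  induction d using SimplexCategory.rec with | _ d
  have h3 := hsurj x hxS
  have hy : E.inv.app _ ⟨x, hxS⟩ ∈ Λ[m + 1, k'].obj (op ⦋d⦌) := by
    rw [← key]
    change p.app _ _ ∈ A.obj _
    rw [h3]; exact hxA
  have h4 := ConcreteCategory.congr_hom (congr_app hσ (op ⦋d⦌)) ⟨_, hy⟩
  have h5 : q.app _ ⟨_, hy⟩ = (⟨x, hxA⟩ : A.obj (op ⦋d⦌)) := Subtype.ext h3
  change f.app _ (q.app _ ⟨_, hy⟩) = σ.app _ _ at h4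
  rw [h5] at h4
  exact h4

/-- Let `A ≤ B` be subcomplexes of `Δ[N]` and `k` a vertex such that adding or removing `k`
preserves the set of the simplices of `B` that are not in `A`, and that `k` is always an inner
vertex. Then maps from `A` to a quasi-category extend to `B`. -/
lemma Quasicategory.exists_extension_of_toggle {C : SSet.{u}} [C.Quasicategory] {N : ℕ}
    (A B : (Δ[N] : SSet.{u}).Subcomplex) (hAB : A ≤ B) (k : Fin (N + 1))
    (H : ∀ S : Finset (Fin (N + 1)), face S ≤ B → ¬ face S ≤ A →
      face (insert k S) ≤ B ∧ ¬ face (S.erase k) ≤ A ∧ (∃ i ∈ S, i < k) ∧ ∃ i ∈ S, k < i)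
    (f : (A : SSet.{u}) ⟶ C) :
    ∃ g : (B : SSet.{u}) ⟶ C, Subcomplex.homOfLE hAB ≫ g = f := by
  classical
  induction hc : (Finset.univ.filter
    (fun S : Finset (Fin (N + 1)) ↦ face.{u} S ≤ B ∧ ¬ face.{u} S ≤ A)).card
    using Nat.strong_induction_on generalizing A with
  | _ c ih =>
    by_cases hBA : B ≤ A
    · obtain rfl := le_antisymm hAB hBA
      exact ⟨f, rfl⟩
    have hne : ∃ S : Finset (Fin (N + 1)), face.{u} S ≤ B ∧ ¬ face.{u} S ≤ A := by
      by_contra! hcon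
      apply hBA
      rw [Subcomplex.le_iff_contains_nonDegenerate]
      intro d x hx
      rw [← Subcomplex.ofSimplex_le_iff, ← face_nonDegenerateEquiv'] at hx ⊢
      exact hcon _ hx
    -- A minimal missing face `S` cannot contain `k`, since `S.erase k` would be a smaller missing
    -- face. Attaching `insert k S` then adds exactly the pair `S`, `insert k S`.
    obtain ⟨S, ⟨hSB, hSA⟩, hmin⟩ := exists_minimal_of_wellFoundedLT
      (fun S : Finset (Fin (N + 1)) ↦ face.{u} S ≤ B ∧ ¬ face.{u} S ≤ A) hne
    have hmin' : ∀ T : Finset (Fin (N + 1)), T ⊂ S → face.{u} T ≤ A := by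
      intro T hT
      by_contra h
      exact hT.2 (hmin ⟨((face_le_face_iff _ _).2 hT.1).trans hSB, h⟩ hT.1)
    obtain ⟨hins, her, ⟨i₀, hi₀, hi₀k⟩, ⟨i₁, hi₁, hi₁k⟩⟩ := H S hSB hSA
    have hkS : k ∉ S := fun h ↦ her (hmin' _ (Finset.erase_ssubset h))
    obtain ⟨g, hg⟩ := Quasicategory.exists_extension_sup_face A k (insert k S)
      (Finset.mem_insert_self _ _) ⟨i₀, by simp [hi₀], hi₀k⟩ ⟨i₁, by simp [hi₁], hi₁k⟩
      (by rwa [Finset.erase_insert hkS]) (fun j hj hjk ↦ by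
        by_contra h
        have hjS : j ∈ S := (Finset.mem_insert.1 hj).resolve_left hjk
        have := (H ((insert k S).erase j)
          (((face_le_face_iff _ _).2 (Finset.erase_subset _ _)).trans hins) h).2.1
        refine this (hmin' _ ?_)
        rw [Finset.erase_right_comm, Finset.erase_insert hkS]
        exact Finset.erase_ssubset hjS) f
    have hle : A ⊔ face (insert k S) ≤ B := sup_le hAB hins
    obtain ⟨g', hg'⟩ := ih _ (by
      rw [← hc]
      refine Finset.card_lt_card ⟨fun T hT ↦ ?_, fun hsub ↦ ?_⟩
      · simp only [Finset.mem_filter, Finset.mem_univ, true_and] at hT ⊢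
        exact ⟨hT.1, fun h ↦ hT.2 (h.trans le_sup_left)⟩
      · have := hsub (Finset.mem_filter.2 ⟨Finset.mem_univ _, hSB, hSA⟩)
        simp only [Finset.mem_filter, Finset.mem_univ, true_and] at this
        exact this.2 (((face_le_face_iff _ _).2 (Finset.subset_insert _ _)).trans le_sup_right))
      (A ⊔ face (insert k S)) hle (fun T hTB hTA ↦ by
        rw [face_le_sup_iff, not_or] at hTA
        obtain ⟨h1, h2, h3, h4⟩ := H T hTB hTA.1
        refine ⟨h1, ?_, h3, h4⟩
        rw [face_le_sup_iff, not_or]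
        -- The hypothesis survives the enlargement of `A`: `insert k S` contains `k`, so it contains
        -- `T` as soon as it contains `T.erase k`.
        refine ⟨h2, fun h ↦ hTA.2 ?_⟩
        rw [face_le_face_iff] at h ⊢
        intro i hi
        by_cases hik : i = k
        · simp [hik]
        · exact h (Finset.mem_erase.2 ⟨hik, hi⟩)) g rfl
    exact ⟨g', by rw [← hg, ← hg']; rfl⟩

end

/-! ### The $3$-simplex attached to an equivalence -/

lemma δ_castPred_δ (C : SSet.{u}) {n : ℕ} (j k : Fin (n + 3)) (hjk : j < k) (x : C _⦋n + 2⦌) :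
    C.δ (j.castPred (Fin.ne_last_of_lt hjk)) (C.δ k x) =
      C.δ (k.pred (Fin.ne_zero_of_lt hjk)) (C.δ j x) := by
  obtain ⟨j, rfl⟩ := j.eq_castSucc_of_ne_last (Fin.ne_last_of_lt hjk)
  obtain ⟨k, rfl⟩ := k.eq_succ_of_ne_zero (Fin.ne_zero_of_lt hjk)
  simp only [Fin.castPred_castSucc, Fin.pred_succ]
  exact C.δ_comp_δ_apply (by simpa [Fin.castSucc_lt_succ_iff] using hjk) x

/-- An equivalence `f` in a quasi-category and an inverse can be chosen to fit into a `3`-simplex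
`a, b, a, b` two of whose faces are degeneracies of `f`. -/
lemma Edge.InvStruct.exists_threeSimplex {C : SSet.{u}} [C.Quasicategory] {a b : C _⦋0⦌}
    {f : Edge a b} (I : f.InvStruct) :
    ∃ P : C _⦋3⦌, C.δ 1 P = C.σ 0 f.edge ∧ C.δ 2 P = C.σ 1 f.edge := by
  let τ := I.invHomId.simplex
  let σ := I.homInvId.simplex
  have hσ2 : C.δ 2 σ = f.edge := I.homInvId.d₂
  have hσ0 : C.δ 0 σ = I.inv.edge := I.homInvId.d₀
  have hσ1 : C.δ 1 σ = C.σ 0 a := I.homInvId.d₁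
  have hτ2 : C.δ 2 τ = I.inv.edge := I.invHomId.d₂
  have hτ0 : C.δ 0 τ = f.edge := I.invHomId.d₀
  have hτ1 : C.δ 1 τ = C.σ 0 b := I.invHomId.d₁
  -- faces of degenerate simplices
  have s00 (x : C _⦋1⦌) : C.δ 0 (C.σ 0 x) = x := C.δ_comp_σ_self_apply 0 x
  have s10 (x : C _⦋1⦌) : C.δ 1 (C.σ 0 x) = x := C.δ_comp_σ_succ_apply 0 x
  have s20 (x : C _⦋1⦌) : C.δ 2 (C.σ 0 x) = C.σ 0 (C.δ 1 x) :=
    C.δ_comp_σ_of_gt_apply (n := 0) (i := 1) (j := 0) (by decide) x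
  have s01 (x : C _⦋1⦌) : C.δ 0 (C.σ 1 x) = C.σ 0 (C.δ 0 x) :=
    C.δ_comp_σ_of_le_apply (n := 0) (i := 0) (j := 0) (by decide) x
  have s11 (x : C _⦋1⦌) : C.δ 1 (C.σ 1 x) = x := C.δ_comp_σ_self_apply 1 x
  have s21 (x : C _⦋1⦌) : C.δ 2 (C.σ 1 x) = x := C.δ_comp_σ_succ_apply 1 x
  have t00 (x : C _⦋2⦌) : C.δ 0 (C.σ 0 x) = x := C.δ_comp_σ_self_apply 0 x
  have t10 (x : C _⦋2⦌) : C.δ 1 (C.σ 0 x) = x := C.δ_comp_σ_succ_apply 0 x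
  have t20 (x : C _⦋2⦌) : C.δ 2 (C.σ 0 x) = C.σ 0 (C.δ 1 x) :=
    C.δ_comp_σ_of_gt_apply (n := 1) (i := 1) (j := 0) (by decide) x
  have t30 (x : C _⦋2⦌) : C.δ 3 (C.σ 0 x) = C.σ 0 (C.δ 2 x) :=
    C.δ_comp_σ_of_gt_apply (n := 1) (i := 2) (j := 0) (by decide) x
  have v1 (x : C _⦋0⦌) : C.δ 1 (C.σ 0 x) = x := C.δ_comp_σ_succ_apply 0 x
  have v0 (x : C _⦋0⦌) : C.δ 0 (C.σ 0 x) = x := C.δ_comp_σ_self_apply 0 x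
  -- On vertices $a, b, a, b$. Its face $d_1$ is as wanted, but $d_2 = \rho$ on $a, b, b$ need not
  -- be degenerate; the other fillers correct this.
  obtain ⟨z₁, h₁⟩ := Quasicategory.exists_filler (C := C) (n := 1) 2 (by decide) (by decide)
    ![τ, C.σ 0 f.edge, τ, σ] (by
      intro j k hj hk hjk
      have e01 : C.δ 0 τ = C.δ 0 (C.σ 0 f.edge) := by rw [hτ0, s00]
      have e03 : C.δ 2 τ = C.δ 0 σ := by rw [hτ2, hσ0]
      have e13 : C.δ 2 (C.σ 0 f.edge) = C.δ 1 σ := by rw [s20, hσ1, f.src_eq]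
      fin_cases j <;> fin_cases k <;>
        first
        | exact (hj rfl).elim
        | exact (hk rfl).elim
        | exact (absurd hjk (by decide))
        | exact e01
        | exact e03
        | exact e13)
  have h10 : C.δ 0 z₁ = τ := h₁ 0 (by decide)
  have h11 : C.δ 1 z₁ = C.σ 0 f.edge := h₁ 1 (by decide)
  have h13 : C.δ 3 z₁ = σ := h₁ 3 (by decide)
  let ρ := C.δ 2 z₁
  have hρ2 : C.δ 2 ρ = f.edge := by
    have : C.δ 2 (C.δ 3 z₁) = C.δ 2 ρ := C.δ_castPred_δ 2 3 (by decide) z₁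
    rw [← this, h13, hσ2]
  have hρ1 : C.δ 1 ρ = f.edge := by
    have : C.δ 1 ρ = C.δ 1 (C.δ 1 z₁) := C.δ_castPred_δ 1 2 (by decide) z₁
    rw [this, h11, s10]
  have hρ0 : C.δ 0 ρ = C.σ 0 b := by
    have : C.δ 0 ρ = C.δ 1 (C.δ 0 z₁) := C.δ_castPred_δ 0 2 (by decide) z₁
    rw [this, h10, hτ1]
  -- On $a, b, b, b$: this makes $\rho'$ a correction that composes with $\rho$ to the degenerate
  -- $\sigma_1 f$.
  obtain ⟨z₂, h₂⟩ := Quasicategory.exists_filler (C := C) (n := 1) 1 (by decide) (by decide)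
    ![C.σ 0 (C.σ 0 b), τ, C.σ 1 f.edge, ρ] (by
      intro j k hj hk hjk
      have e02 : C.δ 1 (C.σ 0 (C.σ 0 b)) = C.δ 0 (C.σ 1 f.edge) := by
        rw [s10, s01, f.tgt_eq]
      have e03 : C.δ 2 (C.σ 0 (C.σ 0 b)) = C.δ 0 ρ := by rw [s20, v1, hρ0]
      have e23 : C.δ 2 (C.σ 1 f.edge) = C.δ 2 ρ := by rw [s21, hρ2]
      fin_cases j <;> fin_cases k <;>
        first
        | exact (hj rfl).elim
        | exact (hk rfl).elim
        | exact (absurd hjk (by decide))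
        | exact e02
        | exact e03
        | exact e23)
  have h20 : C.δ 0 z₂ = C.σ 0 (C.σ 0 b) := h₂ 0 (by decide)
  have h22 : C.δ 2 z₂ = C.σ 1 f.edge := h₂ 2 (by decide)
  have h23 : C.δ 3 z₂ = ρ := h₂ 3 (by decide)
  let ρ' := C.δ 1 z₂
  have hρ2' : C.δ 2 ρ' = f.edge := by
    have : C.δ 1 (C.δ 3 z₂) = C.δ 2 ρ' := C.δ_castPred_δ 1 3 (by decide) z₂
    rw [← this, h23, hρ1]
  have hρ1' : C.δ 1 ρ' = f.edge := by
    have : C.δ 1 (C.δ 2 z₂) = C.δ 1 ρ' := C.δ_castPred_δ 1 2 (by decide) z₂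
    rw [← this, h22, s11]
  have hρ0' : C.δ 0 ρ' = C.σ 0 b := by
    have : C.δ 0 ρ' = C.δ 0 (C.δ 0 z₂) := C.δ_castPred_δ 0 1 (by decide) z₂
    rw [this, h20, s00]
  -- On $b, a, b, b$: the remaining face needed to combine $z_1$ and $z_2$.
  obtain ⟨z₃, h₃⟩ := Quasicategory.exists_filler (C := C) (n := 1) 2 (by decide) (by decide)
    ![ρ', C.σ 0 (C.σ 0 b), τ, τ] (by
      intro j k hj hk hjk
      have e01 : C.δ 0 ρ' = C.δ 0 (C.σ 0 (C.σ 0 b)) := by rw [hρ0', s00]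
      have e03 : C.δ 2 ρ' = C.δ 0 τ := by rw [hρ2', hτ0]
      have e13 : C.δ 2 (C.σ 0 (C.σ 0 b)) = C.δ 1 τ := by rw [s20, v1, hτ1]
      fin_cases j <;> fin_cases k <;>
        first
        | exact (hj rfl).elim
        | exact (hk rfl).elim
        | exact (absurd hjk (by decide))
        | exact e01
        | exact e03
        | exact e13)
  have h30 : C.δ 0 z₃ = ρ' := h₃ 0 (by decide)
  have h31 : C.δ 1 z₃ = C.σ 0 (C.σ 0 b) := h₃ 1 (by decide)
  have h33 : C.δ 3 z₃ = τ := h₃ 3 (by decide)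
  -- On $a, b, a, b, b$. The new face $d_3$, on vertices $0, 1, 2, 4$, is the result: its $d_1$ lies
  -- in `C.σ 0 ρ'` and its $d_2$ lies in $z_2$.
  obtain ⟨z₄, h₄⟩ := Quasicategory.exists_filler (C := C) (n := 2) 3 (by decide) (by decide)
    ![z₃, C.σ 0 ρ', z₂, z₁, z₁] (by
      intro j k hj hk hjk
      have e01 : C.δ 0 z₃ = C.δ 0 (C.σ 0 ρ') := by rw [h30, t00]
      have e02 : C.δ 1 z₃ = C.δ 0 z₂ := by rw [h31, h20]
      have e04 : C.δ 3 z₃ = C.δ 0 z₁ := by rw [h33, h10]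
      have e12 : C.δ 1 (C.σ 0 ρ') = C.δ 1 z₂ := by rw [t10]
      have e14 : C.δ 3 (C.σ 0 ρ') = C.δ 1 z₁ := by rw [t30, hρ2', h11]
      have e24 : C.δ 3 z₂ = C.δ 2 z₁ := by rw [h23]
      fin_cases j <;> fin_cases k <;>
        first
        | exact (hj rfl).elim
        | exact (hk rfl).elim
        | exact (absurd hjk (by decide))
        | exact e01
        | exact e02
        | exact e04
        | exact e12
        | exact e14
        | exact e24)
  have h41 : C.δ 1 z₄ = C.σ 0 ρ' := h₄ 1 (by decide)
  have h42 : C.δ 2 z₄ = z₂ := h₄ 2 (by decide)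
  refine ⟨C.δ 3 z₄, ?_, ?_⟩
  · have : C.δ 1 (C.δ 3 z₄) = C.δ 2 (C.δ 1 z₄) := C.δ_castPred_δ 1 3 (by decide) z₄
    rw [this, h41, t20, hρ1']
  · have : C.δ 2 (C.δ 3 z₄) = C.δ 2 (C.δ 2 z₄) := C.δ_castPred_δ 2 3 (by decide) z₄
    rw [this, h42, h22]

/-! ### Joyal's extension theorem for $\Lambda[q+2,0]$ -/

namespace stdSimplex

/-- The subcomplex of `Δ[N]` consisting of the simplices whose set of vertices satisfies a
predicate that is stable under passing to subsets. -/
def ofVertices {N : ℕ} (P : Set (Fin (N + 1)) → Prop) (hP : ∀ U V, U ⊆ V → P V → P U) :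
    (Δ[N] : SSet.{u}).Subcomplex where
  obj _ := {s | P (Set.range (asOrderHom s))}
  map _ s hs := hP _ (Set.range (asOrderHom s)) (by rintro _ ⟨i, rfl⟩; exact ⟨_, rfl⟩) hs

/-- The face is generated by the simplex enumerating `S`, so only its vertex set is tested. The
empty face has no simplices, whence the exceptional case. -/
lemma face_le_ofVertices_iff {N : ℕ} (P : Set (Fin (N + 1)) → Prop)
    (hP : ∀ U V, U ⊆ V → P V → P U) (S : Finset (Fin (N + 1))) :
    face.{u} S ≤ ofVertices P hP ↔ S = ∅ ∨ P S := by
  obtain rfl | hS := S.eq_empty_or_nonempty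
  · simp
  · obtain ⟨m, hm⟩ : ∃ m, S.card = m + 1 := ⟨S.card - 1, by have := hS.card_pos; omega⟩
    rw [face_eq_ofSimplex S m (S.orderIsoOfFin hm), Subcomplex.ofSimplex_le_iff]
    simp only [hS.ne_empty, false_or]
    have : Set.range (asOrderHom (objMk.{u} (n := ⦋N⦌) (m := op ⦋m⦌)
        ((OrderHom.Subtype.val (· ∈ S)).comp
          (S.orderIsoOfFin hm).toOrderEmbedding.toOrderHom))) = S := by
      ext i
      constructor
      · rintro ⟨j, rfl⟩
        exact (S.orderIsoOfFin hm j).2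
      · intro hi
        exact ⟨(S.orderIsoOfFin hm).symm ⟨i, hi⟩, congrArg Subtype.val
          ((S.orderIsoOfFin hm).apply_symm_apply ⟨i, hi⟩)⟩
    change P _ ↔ _
    rw [this]

/-- A map from a subcomplex of `Δ[N]` to `Δ[M]` that is given on vertices. -/
def mapOfVertices {N M : ℕ} (A : (Δ[N] : SSet.{u}).Subcomplex) (r : Fin (N + 1) → Fin (M + 1))
    (hr : ∀ m (s : Δ[N].obj m), s ∈ A.obj m → Monotone (r ∘ asOrderHom s)) :
    (A : SSet.{u}) ⟶ Δ[M] where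
  app m := ↾fun s ↦ objMk ⟨r ∘ asOrderHom s.1, hr m s.1 s.2⟩
  naturality _ _ _ := rfl

end stdSimplex

/-- The edge `0 → 1` of the horn `Λ[q + 2, 0]`. -/
def hornZeroEdge (q : ℕ) : (Λ[q + 2, 0] : SSet.{u}) _⦋1⦌ :=
  horn.edge (q + 2) 0 0 1 (Fin.zero_le _) (by
    rw [Finset.insert_eq_of_mem (Finset.mem_insert_self _ _)]
    exact Finset.card_le_two.trans (by omega))

open _root_.SSet.stdSimplex in
/-- Joyal's extension theorem: a horn `Λ[q + 2, 0]` in a quasi-category whose edge `0 → 1` is an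
equivalence has a filler. -/
theorem Quasicategory.exists_extension_horn_zero {C : SSet.{u}} [C.Quasicategory] (q : ℕ)
    (h : (Λ[q + 2, 0] : SSet.{u}) ⟶ C)
    (hf : C.IsEquivalenceEdge (h.app _ (hornZeroEdge q))) :
    ∃ g : Δ[q + 2] ⟶ C, Λ[q + 2, 0].ι ≫ g = h := by
  obtain ⟨I⟩ := hf
  obtain ⟨P, hP1, hP2⟩ := I.exists_threeSimplex
  simp only [Edge.mk'_edge] at hP1 hP2
  -- Vertices $0, 1, 2, 3$ of $\Delta[q+4]$ will carry `P`; vertices $t \ge 4$ stand for the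
  -- vertices $t - 2$ of the horn, and `miss` says that one of them is omitted.
  let no (a : ℕ) (U : Set (Fin (q + 5))) : Prop := ∀ i ∈ U, i.val ≠ a
  have hno : ∀ a U V, U ⊆ V → no a V → no a U := fun a U V hUV hV i hi ↦ hV i (hUV hi)
  let miss (U : Set (Fin (q + 5))) : Prop := ∃ t : Fin (q + 5), 4 ≤ t.val ∧ t ∉ U
  have hmiss : ∀ U V, U ⊆ V → miss V → miss U := fun U V hUV ⟨t, ht, hV⟩ ↦
    ⟨t, ht, fun h ↦ hV (hUV h)⟩
  let P0 (U : Set (Fin (q + 5))) : Prop := ∀ i ∈ U, i.val < 4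
  have hP0 : ∀ U V, U ⊆ V → P0 V → P0 U := fun U V hUV hV i hi ↦ hV i (hUV hi)
  let P1 (U : Set (Fin (q + 5))) : Prop := (miss U ∧ (no 1 U ∨ no 2 U)) ∨ (no 1 U ∧ no 3 U)
  have hP1' : ∀ U V, U ⊆ V → P1 V → P1 U := fun U V hUV hV ↦
    hV.imp (fun h ↦ ⟨hmiss _ _ hUV h.1, h.2.imp (hno _ _ _ hUV) (hno _ _ _ hUV)⟩)
      (fun h ↦ ⟨hno _ _ _ hUV h.1, hno _ _ _ hUV h.2⟩)
  let PA (U : Set (Fin (q + 5))) : Prop := miss U ∨ (no 1 U ∧ no 3 U)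
  have hPA : ∀ U V, U ⊆ V → PA V → PA U := fun U V hUV hV ↦
    hV.imp (hmiss _ _ hUV) (fun h ↦ ⟨hno _ _ _ hUV h.1, hno _ _ _ hUV h.2⟩)
  let PB (U : Set (Fin (q + 5))) : Prop := PA U ∨ no 3 U
  have hPB : ∀ U V, U ⊆ V → PB V → PB U := fun U V hUV hV ↦
    hV.imp (hPA _ _ hUV) (hno _ _ _ hUV)
  let A0 : (Δ[q + 4] : SSet.{u}).Subcomplex := ofVertices P0 hP0
  let A1 : (Δ[q + 4] : SSet.{u}).Subcomplex := ofVertices P1 hP1'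
  let A' : (Δ[q + 4] : SSet.{u}).Subcomplex := ofVertices PA hPA
  let B : (Δ[q + 4] : SSet.{u}).Subcomplex := ofVertices PB hPB
  -- the map on `A0`
  let r0 : Fin (q + 5) → Fin 4 := fun i ↦ ⟨min i.val 3, by omega⟩
  have hr0 : Monotone r0 := fun i j hij ↦ by
    simp only [r0, Fin.le_def] at hij ⊢; omega
  let φ0 : (A0 : SSet.{u}) ⟶ C :=
    mapOfVertices A0 r0 (fun m s _ ↦ hr0.comp (asOrderHom s).monotone) ≫ yonedaEquiv.symm P
  -- the map on `A1`
  let r1 : Fin (q + 5) → Fin (q + 3) := fun i ↦ ⟨if i.val < 2 then i.val else i.val - 2, by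
    split_ifs <;> omega⟩
  -- `r1` follows the pattern $a, b, a, b$, so it reverses order only between vertices $1$ and $2$,
  -- which never occur together in `A1`.
  have hr1 : ∀ m (s : Δ[q + 4].obj m), s ∈ A1.obj m → Monotone (r1 ∘ asOrderHom s) := by
    intro m s hs i j hij
    have hij' := (asOrderHom s).monotone hij
    have h12 : no 1 (Set.range (asOrderHom s)) ∨ no 2 (Set.range (asOrderHom s)) := by
      rcases hs with hs | hs
      · exact hs.2
      · exact Or.inl hs.1
    simp only [r1, Function.comp_apply, Fin.le_def] at hij' ⊢
    rcases h12 with h12 | h12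
    · have hi := h12 _ ⟨i, rfl⟩
      have hj := h12 _ ⟨j, rfl⟩
      split_ifs <;> omega
    · have hi := h12 _ ⟨i, rfl⟩
      have hj := h12 _ ⟨j, rfl⟩
      split_ifs <;> omega
  let ψ1 : (A1 : SSet.{u}) ⟶ (Λ[q + 2, 0] : SSet.{u}) :=
    Subcomplex.lift (mapOfVertices A1 r1 hr1) (by
      rintro ⟨d⟩ _ ⟨⟨s, hs⟩, rfl⟩
      induction d using SimplexCategory.rec with | _ d
      rw [mem_horn_iff_notMem_range]
      rcases hs with ⟨⟨t, ht, hts⟩, -⟩ | ⟨hs1, hs3⟩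
      · refine ⟨⟨t.val - 2, by omega⟩, ?_, ?_⟩
        · rw [ne_eq, Fin.ext_iff]; simp; omega
        · rintro ⟨i, hi⟩
          have hi' : (r1 (asOrderHom s i)) = ⟨t.val - 2, by omega⟩ := hi
          simp only [r1, Fin.mk.injEq] at hi'
          apply hts
          refine ⟨i, Fin.ext ?_⟩
          split_ifs at hi' <;> omega
      · refine ⟨1, by simp, ?_⟩
        rintro ⟨i, hi⟩
        have hi' : (r1 (asOrderHom s i)) = 1 := hi
        have h1 := hs1 _ ⟨i, rfl⟩
        have h3 := hs3 _ ⟨i, rfl⟩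
        simp only [r1, Fin.ext_iff, Fin.val_one] at hi'
        split_ifs at hi' <;> omega)
  have sq : Subcomplex.BicartSq (A0 ⊓ A1) A0 A1 (A0 ⊔ A1) := ⟨rfl, rfl⟩
  -- A simplex of the overlap lies on vertices $0, \dots, 3$ and omits $1$ or $2$, hence lies in
  -- $d_1 P$ or $d_2 P$. Both are degeneracies of $f$, which is what `r1` followed by `h` gives.
  have hcomp : Subcomplex.homOfLE sq.le₁₂ ≫ φ0 = Subcomplex.homOfLE sq.le₁₃ ≫ ψ1 ≫ h := by
    ext ⟨d⟩ ⟨s, hs0, hs1⟩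
    induction d using SimplexCategory.rec with | _ d
    have hs0' : ∀ i, (asOrderHom s i).val < 4 := fun i ↦ hs0 _ ⟨i, rfl⟩
    have h12 : no 1 (Set.range (asOrderHom s)) ∨ no 2 (Set.range (asOrderHom s)) := by
      rcases hs1 with hs | hs
      · exact hs.2
      · exact Or.inl hs.1
    let s3 : ⦋d⦌ ⟶ ⦋3⦌ := SimplexCategory.Hom.mk ⟨r0 ∘ asOrderHom s,
      hr0.comp (asOrderHom s).monotone⟩
    have hs3 : ∀ i, (s3 i).val = (asOrderHom s i).val := fun i ↦ by
      change min _ 3 = _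
      have := hs0' i
      omega
    change C.map s3.op P = h.app _ (ψ1.app _ ⟨s, hs1⟩)
    have key : ∀ (u : ⦋d⦌ ⟶ ⦋1⦌), (∀ i, (u i).val = (r1 (asOrderHom s i)).val) →
        C.map u.op (h.app _ (hornZeroEdge q)) = h.app _ (ψ1.app _ ⟨s, hs1⟩) := by
      intro u hu
      rw [← NatTrans.naturality_apply]
      congr 1
      refine Subtype.ext (stdSimplex.ext _ _ fun i ↦ ?_)
      change (![0, 1] (u i) : Fin (q + 3)) = r1 (asOrderHom s i)
      apply Fin.ext
      rw [← hu i]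
      generalize u i = a
      fin_cases a <;> rfl
    rcases h12 with h12 | h12
    · have e : s3 = (s3 ≫ SimplexCategory.σ 0) ≫ SimplexCategory.δ 1 := by
        ext i : 3
        have h1 : (s3 i).val ≠ 1 := by rw [hs3]; exact h12 _ ⟨i, rfl⟩
        change s3 i = Fin.succAbove 1 (Fin.predAbove 0 (s3 i))
        revert h1
        generalize s3 i = a
        revert a
        decide
      rw [e, op_comp, Functor.map_comp_apply]
      change C.map _ (C.δ 1 P) = _
      rw [hP1]
      refine Eq.trans ?_ (key (s3 ≫ SimplexCategory.σ 0 ≫ SimplexCategory.σ 0) ?_)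
      · exact (ConcreteCategory.congr_hom (C.map_comp (SimplexCategory.σ 0).op
          (s3 ≫ SimplexCategory.σ 0).op) _).symm
      · intro i
        have h1 : (s3 i).val ≠ 1 := by rw [hs3]; exact h12 _ ⟨i, rfl⟩
        have h2 := hs3 i
        change (Fin.predAbove (0 : Fin 2) (Fin.predAbove (0 : Fin 3) (s3 i))).val =
          if _ then _ else _
        rw [← h2]
        revert h1
        generalize s3 i = a
        revert a
        decide
    · have e : s3 = (s3 ≫ SimplexCategory.σ 1) ≫ SimplexCategory.δ 2 := by
        ext i : 3
        have h1 : (s3 i).val ≠ 2 := by rw [hs3]; exact h12 _ ⟨i, rfl⟩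
        change s3 i = Fin.succAbove 2 (Fin.predAbove 1 (s3 i))
        revert h1
        generalize s3 i = a
        revert a
        decide
      rw [e, op_comp, Functor.map_comp_apply]
      change C.map _ (C.δ 2 P) = _
      rw [hP2]
      refine Eq.trans ?_ (key (s3 ≫ SimplexCategory.σ 1 ≫ SimplexCategory.σ 1) ?_)
      · exact (ConcreteCategory.congr_hom (C.map_comp (SimplexCategory.σ 1).op
          (s3 ≫ SimplexCategory.σ 1).op) _).symm
      · intro i
        have h1 : (s3 i).val ≠ 2 := by rw [hs3]; exact h12 _ ⟨i, rfl⟩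
        have h2 := hs3 i
        change (Fin.predAbove (1 : Fin 2) (Fin.predAbove (1 : Fin 3) (s3 i))).val =
          if _ then _ else _
        rw [← h2]
        revert h1
        generalize s3 i = a
        revert a
        decide
  let φ : ((A0 ⊔ A1 : (Δ[q + 4] : SSet.{u}).Subcomplex) : SSet.{u}) ⟶ C :=
    sq.isPushout.desc φ0 (ψ1 ≫ h) hcomp
  have hφ : Subcomplex.homOfLE sq.le₃₄ ≫ φ = ψ1 ≫ h := sq.isPushout.inr_desc _ _ _
  clear_value φ
  -- the extension to `A'`
  have hA' : A0 ⊔ A1 ≤ A' := by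
    apply sup_le
    · intro d s hs
      exact Or.inl ⟨⟨4, by omega⟩, le_rfl, fun h4 ↦ absurd (hs _ h4) (by simp)⟩
    · rintro d s (hs | hs)
      · exact Or.inl hs.1
      · exact Or.inr hs
  -- A simplex to be added contains $1$, $2$ and some vertex $\ge 4$, and omits another vertex $\ge
  -- 4$. Toggling $3$ changes none of this, and $3$ is inner.
  obtain ⟨g', hg'⟩ := Quasicategory.exists_extension_of_toggle (A0 ⊔ A1) A' hA' ⟨3, by omega⟩ (by
    intro S hSA' hS
    rw [face_le_sup_iff, not_or, face_le_ofVertices_iff, face_le_ofVertices_iff, not_or,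
      not_or] at hS
    rw [face_le_ofVertices_iff] at hSA'
    have hSA := hSA'.resolve_left hS.1.1
    obtain ⟨⟨-, h0⟩, -, h1⟩ := hS
    have hm : miss S := by
      rcases hSA with h | h
      · exact h
      · exact absurd (Or.inr h) h1
    have h1' : ¬ no 1 S := fun h ↦ h1 (Or.inl ⟨hm, Or.inl h⟩)
    have h2' : ¬ no 2 S := fun h ↦ h1 (Or.inl ⟨hm, Or.inr h⟩)
    simp only [no, P0] at h0 h1' h2'
    push Not at h0 h1' h2'
    obtain ⟨i0, hi0, hi0'⟩ := h0
    obtain ⟨i1, hi1, hi1'⟩ := h1'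
    obtain ⟨i2, hi2, hi2'⟩ := h2'
    refine ⟨?_, ?_, ⟨i1, hi1, ?_⟩, ⟨i0, hi0, ?_⟩⟩
    · rw [face_le_ofVertices_iff]
      obtain ⟨t, ht, htS⟩ := hm
      refine Or.inr (Or.inl ⟨t, ht, ?_⟩)
      rw [Finset.coe_insert, Set.mem_insert_iff, not_or]
      exact ⟨fun h ↦ by rw [h] at ht; simp at ht, htS⟩
    · have m0 : i0 ∈ S.erase ⟨3, by omega⟩ := Finset.mem_erase.2
        ⟨fun h ↦ by rw [h] at hi0'; simp at hi0', hi0⟩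
      have m1 : i1 ∈ S.erase ⟨3, by omega⟩ := Finset.mem_erase.2
        ⟨fun h ↦ by rw [h] at hi1'; simp at hi1', hi1⟩
      have m2 : i2 ∈ S.erase ⟨3, by omega⟩ := Finset.mem_erase.2
        ⟨fun h ↦ by rw [h] at hi2'; simp at hi2', hi2⟩
      rw [face_le_sup_iff, not_or, face_le_ofVertices_iff, face_le_ofVertices_iff, not_or,
        not_or]
      refine ⟨⟨Finset.ne_empty_of_mem m0, fun h ↦ ?_⟩, Finset.ne_empty_of_mem m0, ?_⟩
      · exact absurd (h i0 m0) (by omega)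
      · rintro (⟨-, h | h⟩ | ⟨h, -⟩)
        · exact h i1 m1 hi1'
        · exact h i2 m2 hi2'
        · exact h i1 m1 hi1'
    · rw [Fin.lt_def, hi1']; simp
    · rw [Fin.lt_def]; simp; omega) φ
  -- the extension to `B`
  have hB : A' ≤ B := fun d s hs ↦ Or.inl hs
  -- A simplex to be added omits $3$ and contains $1$ and all vertices $\ge 4$. Toggling $2$ changes
  -- none of this, and $2$ is inner.
  obtain ⟨g, hg⟩ := Quasicategory.exists_extension_of_toggle A' B hB ⟨2, by omega⟩ (by
    intro S hSB hS
    rw [face_le_ofVertices_iff, not_or] at hS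
    rw [face_le_ofVertices_iff] at hSB
    have h3 : no 3 S := (hSB.resolve_left hS.1).resolve_left hS.2
    obtain ⟨-, hS⟩ := hS
    have hm : ∀ t : Fin (q + 5), 4 ≤ t.val → t ∈ S := by
      intro t ht
      by_contra h
      exact hS (Or.inl ⟨t, ht, h⟩)
    have h1' : ¬ no 1 S := fun h ↦ hS (Or.inr ⟨h, h3⟩)
    simp only [no] at h1'
    push Not at h1'
    obtain ⟨i1, hi1, hi1'⟩ := h1'
    refine ⟨?_, ?_, ⟨i1, hi1, ?_⟩, ⟨⟨4, by omega⟩, hm _ le_rfl, ?_⟩⟩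
    · rw [face_le_ofVertices_iff]
      refine Or.inr (Or.inr fun i hi ↦ ?_)
      rw [Finset.coe_insert, Set.mem_insert_iff] at hi
      rcases hi with rfl | hi
      · simp
      · exact h3 i hi
    · have m1 : i1 ∈ S.erase ⟨2, by omega⟩ := Finset.mem_erase.2
        ⟨fun h ↦ by rw [h] at hi1'; simp at hi1', hi1⟩
      rw [face_le_ofVertices_iff, not_or]
      refine ⟨Finset.ne_empty_of_mem m1, ?_⟩
      rintro (⟨t, ht, h⟩ | ⟨h, -⟩)
      · exact h (Finset.mem_erase.2 ⟨fun h ↦ by rw [h] at ht; simp at ht, hm t ht⟩)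
      · exact h i1 m1 hi1'
    · rw [Fin.lt_def, hi1']; simp
    · rw [Fin.lt_def]; simp) g'
  -- the restriction to `Δ[q + 2]`
  let j : Fin (q + 3) → Fin (q + 5) := fun i ↦ ⟨if i.val < 2 then i.val else i.val + 2, by
    split_ifs <;> omega⟩
  have hj : Monotone j := fun a b hab ↦ by
    simp only [j, Fin.le_def] at hab ⊢
    split_ifs <;> omega
  have hjr : ∀ i, r1 (j i) = i := fun i ↦ by
    apply Fin.ext
    simp only [r1, j]
    split_ifs <;> omega
  let J : Δ[q + 2] ⟶ Δ[q + 4] := SSet.stdSimplex.map (SimplexCategory.Hom.mk ⟨j, hj⟩)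
  have hJ : ∀ {m} (s : Δ[q + 2].obj m), ⇑(asOrderHom (J.app m s)) = j ∘ asOrderHom s :=
    fun s ↦ rfl
  let K : Δ[q + 2] ⟶ (B : SSet.{u}) := Subcomplex.lift J (by
    rintro m _ ⟨s, rfl⟩
    refine Or.inr ?_
    rintro _ ⟨i, rfl⟩
    change (j _).val ≠ 3
    simp only [j]
    split_ifs <;> omega)
  refine ⟨K ≫ g, ?_⟩
  ext ⟨d⟩ ⟨s, hs⟩
  induction d using SimplexCategory.rec with | _ d
  -- A simplex of the horn omits some $t \ne 0$. If $t = 1$, its image under `J` omits $1$ and $3$;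
  -- otherwise it omits $t + 2 \ge 4$ and $2$.
  have hs1 : J.app _ s ∈ A1.obj (op ⦋d⦌) := by
    rw [mem_horn_iff_notMem_range] at hs
    obtain ⟨t, ht0, ht⟩ := hs
    by_cases ht1 : t.val < 2
    · refine Or.inr ⟨?_, ?_⟩
      · rintro _ ⟨i, rfl⟩
        change (j (asOrderHom s i)).val ≠ 1
        intro hi
        refine ht ⟨i, Fin.ext ?_⟩
        change (asOrderHom s i).val = t.val
        rw [ne_eq, Fin.ext_iff, Fin.val_zero] at ht0
        simp only [j] at hi
        split_ifs at hi <;> omega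
      · rintro _ ⟨i, rfl⟩
        change (j (asOrderHom s i)).val ≠ 3
        simp only [j]
        split_ifs <;> omega
    · refine Or.inl ⟨⟨⟨t.val + 2, by omega⟩, by simp; omega, ?_⟩, Or.inr ?_⟩
      · rintro ⟨i, hi⟩
        replace hi : (j (asOrderHom s i)) = _ := hi
        refine ht ⟨i, Fin.ext ?_⟩
        change (asOrderHom s i).val = t.val
        simp only [j, Fin.mk.injEq] at hi
        split_ifs at hi <;> omega
      · rintro _ ⟨i, rfl⟩
        change (j (asOrderHom s i)).val ≠ 2
        simp only [j]
        split_ifs <;> omega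
  have e1 := ConcreteCategory.congr_hom (congr_app hg (op ⦋d⦌)) ⟨_, hA' _ (Or.inr hs1)⟩
  have e2 := ConcreteCategory.congr_hom (congr_app hg' (op ⦋d⦌)) ⟨_, Or.inr hs1⟩
  have e3 := ConcreteCategory.congr_hom (congr_app hφ (op ⦋d⦌)) ⟨_, hs1⟩
  have e4 : ψ1.app (op ⦋d⦌) ⟨_, hs1⟩ = ⟨s, hs⟩ := by
    refine Subtype.ext (stdSimplex.ext _ _ fun i ↦ ?_)
    exact hjr _
  have e5 : (ψ1 ≫ h).app (op ⦋d⦌) ⟨_, hs1⟩ = h.app _ ⟨s, hs⟩ := congrArg (h.app _) e4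
  exact (e1.trans e2).trans (e3.trans e5)

/-! ### Opposites and the last outer horn -/

lemma exists_isHornFamily {C : SSet.{u}} {n : ℕ} {i : Fin (n + 3)}
    (f : (Λ[n + 2, i] : SSet.{u}) ⟶ C) :
    ∃ y : Fin (n + 3) → C _⦋n + 1⦌, C.IsHornFamily i y ∧
      ∀ j (hj : j ≠ i), f.app _ (horn.face i j hj) = y j := by
  obtain ⟨y, hy⟩ : ∃ y : Fin (n + 3) → C _⦋n + 1⦌,
      ∀ j (hj : j ≠ i), f.app _ (horn.face i j hj) = y j :=
    -- The constant simplex is a dummy value at `i`.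
    ⟨fun j ↦ if hj : j ≠ i then f.app _ (horn.face i j hj) else f.app _ (horn.const n i 0 _),
      fun j hj ↦ by symm; exact dif_pos hj⟩
  refine ⟨y, fun j k hj hk hjk ↦ ?_, hy⟩
  rw [← hy j hj, ← hy k hk, SimplicialObject.δ, SimplicialObject.δ, ← NatTrans.naturality_apply,
    ← NatTrans.naturality_apply]
  congr 1
  exact Subtype.ext (δ_castPred_δ Δ[n + 2] j k hjk (stdSimplex.objEquiv.symm (𝟙 _))).symm

lemma exists_extension_of_filler {C : SSet.{u}} {n : ℕ} {i : Fin (n + 3)}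
    (f : (Λ[n + 2, i] : SSet.{u}) ⟶ C) (z : C _⦋n + 2⦌)
    (hz : ∀ j (hj : j ≠ i), C.δ j z = f.app _ (horn.face i j hj)) :
    Λ[n + 2, i].ι ≫ yonedaEquiv.symm z = f :=
  horn.hom_ext _ _ fun j hj ↦ (hz j hj)

lemma rev_pred_rev {n : ℕ} (j : Fin (n + 2)) (h' : j ≠ Fin.last _)
    (h : j.rev ≠ 0) :
    (j.rev.pred h).rev = j.castPred h' := by
  ext
  have := Fin.val_ne_of_ne h'
  simp [Fin.val_rev] at this ⊢
  omega

lemma rev_castPred_rev {n : ℕ} (j : Fin (n + 2)) (h' : j ≠ 0)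
    (h : j.rev ≠ Fin.last _) :
    (j.rev.castPred h).rev = j.pred h' := by
  ext
  have := Fin.val_ne_of_ne h'
  simp [Fin.val_rev] at this ⊢
  omega

/-- The opposite of a quasi-category is a quasi-category. -/
instance (C : SSet.{u}) [C.Quasicategory] : C.op.Quasicategory := by
  refine quasicategory_of_filler _ fun n i f h0 hn ↦ ?_
  obtain ⟨y, hy, hfy⟩ := exists_isHornFamily f
  obtain ⟨z, hz⟩ := Quasicategory.exists_filler (C := C) i.rev
    (by rw [Fin.lt_def] at hn ⊢; simp [Fin.val_rev] at hn ⊢; omega)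
    (by rw [Fin.lt_def] at h0 ⊢; simp [Fin.val_rev] at h0 ⊢; omega)
    (fun j ↦ opObjEquiv (y j.rev)) (fun j k hj hk hjk ↦ by
      have := hy k.rev j.rev (fun h ↦ hk (by rw [← h, Fin.rev_rev]))
        (fun h ↦ hj (by rw [← h, Fin.rev_rev])) (Fin.rev_lt_rev.2 hjk)
      rw [op_δ, op_δ] at this
      replace this := opObjEquiv.symm.injective this
      rw [rev_pred_rev j (Fin.ne_last_of_lt hjk),
        rev_castPred_rev k (Fin.ne_zero_of_lt hjk)] at this
      exact this.symm)
  refine ⟨opObjEquiv.symm z, fun j hj ↦ ?_⟩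
  rw [hfy j hj, op_δ, Equiv.apply_symm_apply, hz _ (fun h ↦ hj (Fin.rev_injective h)), Fin.rev_rev,
    Equiv.symm_apply_apply]

/-- The opposite of an inverse of an edge. -/
def Edge.InvStruct.op {C : SSet.{u}} {a b : C _⦋0⦌} {f : Edge a b} (I : f.InvStruct)
    (f' : Edge (X := C.op) (opObjEquiv.symm b) (opObjEquiv.symm a))
    (hf' : f'.edge = opObjEquiv.symm f.edge) : f'.InvStruct where
  inv := Edge.mk (X := C.op) (opObjEquiv.symm I.inv.edge)
    ((op_δ C 1 _).trans (congrArg opObjEquiv.symm I.inv.tgt_eq))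
    ((op_δ C 0 _).trans (congrArg opObjEquiv.symm I.inv.src_eq))
  homInvId := Edge.CompStruct.mk (X := C.op) (opObjEquiv.symm I.invHomId.simplex)
    (((op_δ C 2 _).trans (congrArg opObjEquiv.symm I.invHomId.d₀)).trans hf'.symm)
    ((op_δ C 0 _).trans (congrArg opObjEquiv.symm I.invHomId.d₂))
    (((op_δ C 1 _).trans (congrArg opObjEquiv.symm I.invHomId.d₁)).trans (op_σ C 0 _).symm)
  invHomId := Edge.CompStruct.mk (X := C.op) (opObjEquiv.symm I.homInvId.simplex)
    ((op_δ C 2 _).trans (congrArg opObjEquiv.symm I.homInvId.d₀))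
    (((op_δ C 0 _).trans (congrArg opObjEquiv.symm I.homInvId.d₂)).trans hf'.symm)
    (((op_δ C 1 _).trans (congrArg opObjEquiv.symm I.homInvId.d₁)).trans (op_σ C 0 _).symm)

lemma IsEquivalenceEdge.op {C : SSet.{u}} {s : C _⦋1⦌} (hs : C.IsEquivalenceEdge s) :
    C.op.IsEquivalenceEdge (opObjEquiv.symm s) := by
  obtain ⟨I⟩ := hs
  exact ⟨(I.op (Edge.mk (X := C.op) (opObjEquiv.symm s) (op_δ C 1 _) (op_δ C 0 _)) rfl).ofEq rfl⟩

/-- Joyal's theorem in terms of faces; the edge $0 \to 1$ is read off from the last face. -/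
lemma Quasicategory.exists_filler_zero {C : SSet.{u}} [C.Quasicategory] {n : ℕ}
    (y : Fin (n + 3) → C _⦋n + 1⦌) (hy : C.IsHornFamily 0 y)
    (he : C.IsEquivalenceEdge (C.map (SimplexCategory.mkOfSucc 0).op (y (Fin.last _)))) :
    ∃ z : C _⦋n + 2⦌, ∀ j, j ≠ 0 → C.δ j z = y j := by
  obtain ⟨f, hf⟩ := hy.exists_map
  obtain ⟨g, hg⟩ := Quasicategory.exists_extension_horn_zero n f (by
    rw [← hf _ (Fin.last_pos.ne')] at he
    rw [← NatTrans.naturality_apply] at he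
    convert he using 2
    refine Subtype.ext (stdSimplex.ext _ _ fun i ↦ ?_)
    fin_cases i
    · change 0 = Fin.succAbove (Fin.last _) 0
      simp
    · change 1 = Fin.succAbove (Fin.last _) 1
      simp)
  refine ⟨yonedaEquiv g, fun j hj ↦ ?_⟩
  rw [← hf j hj, ← hg, ← horn.yonedaEquiv_ι, ← yonedaEquiv_comp, horn.ι_ι_assoc,
    stdSimplex.yonedaEquiv_δ_comp]

/-- The case of the opposite quasi-category: `Fin.rev` turns the last horn into the zeroth, and the
edge between the last two vertices into the edge $0 \to 1$. -/
lemma Quasicategory.exists_filler_last {C : SSet.{u}} [C.Quasicategory] {n : ℕ}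
    (y : Fin (n + 3) → C _⦋n + 1⦌) (hy : C.IsHornFamily (Fin.last _) y)
    (he : C.IsEquivalenceEdge (C.map (SimplexCategory.mkOfSucc (Fin.last n)).op (y 0))) :
    ∃ z : C _⦋n + 2⦌, ∀ j, j ≠ Fin.last _ → C.δ j z = y j := by
  obtain ⟨z, hz⟩ := Quasicategory.exists_filler_zero (C := C.op)
    (fun j ↦ opObjEquiv.symm (y j.rev)) (fun j k hj hk hjk ↦ by
      have := hy k.rev j.rev (fun h ↦ hk (by rw [← Fin.rev_rev k, h, Fin.rev_last]))
        (fun h ↦ hj (by rw [← Fin.rev_rev j, h, Fin.rev_last])) (Fin.rev_lt_rev.2 hjk)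
      rw [op_δ, op_δ]
      have this' := Fin.ne_last_of_lt (Fin.rev_lt_rev.2 hjk)
      have this'' := Fin.ne_zero_of_lt (Fin.rev_lt_rev.2 hjk)
      rw [← rev_castPred_rev k (Fin.ne_zero_of_lt hjk) this',
        ← rev_pred_rev j (Fin.ne_last_of_lt hjk) this'', Fin.rev_rev, Fin.rev_rev,
        Equiv.apply_symm_apply, Equiv.apply_symm_apply, this]) (by
      rw [Fin.rev_last]
      convert he.op using 1
      rw [op_map]
      refine congrArg (fun u ↦ opObjEquiv.symm (C.map (Quiver.Hom.op u) (y 0))) ?_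
      ext i : 3
      fin_cases i
      · apply Fin.ext; change n + 1 - (Fin.succ (0 : Fin (n + 1))).val = n; simp
      · apply Fin.ext; change n + 1 - (Fin.castSucc (0 : Fin (n + 1))).val = n + 1; simp)
  refine ⟨opObjEquiv z, fun j hj ↦ ?_⟩
  rw [δ_opObjEquiv, hz _ (fun h ↦ hj (by rw [← Fin.rev_rev j, h, Fin.rev_zero])), Fin.rev_rev,
    Equiv.apply_symm_apply]

/-! ### The homotopy category and 2-out-of-3 -/

instance (C : SSet.{u}) [C.Quasicategory] :
    Truncated.Quasicategory₂ ((truncation 2).obj C) where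
  fill21 {x₀ x₁ x₂} e₀₁ e₁₂ := by
    obtain ⟨z, hz⟩ := Quasicategory.exists_filler (C := C) (n := 0) 1 (by decide) (by decide)
      ![e₁₂.edge, e₁₂.edge, e₀₁.edge] (by
        intro j k hj hk hjk
        have e02 : C.δ 1 e₁₂.edge = C.δ 0 e₀₁.edge := e₁₂.src_eq.trans e₀₁.tgt_eq.symm
        fin_cases j <;> fin_cases k <;>
          first
          | exact (hj rfl).elim
          | exact (hk rfl).elim
          | exact (absurd hjk (by decide))
          | exact e02)
    have h0 : C.δ 0 z = e₁₂.edge := hz 0 (by decide)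
    have h2 : C.δ 2 z = e₀₁.edge := hz 2 (by decide)
    have h1 : C.δ 1 (C.δ 1 z) = x₀ := by
      have : C.δ 1 (C.δ 2 z) = C.δ 1 (C.δ 1 z) := C.δ_castPred_δ 1 2 (by decide) z
      rw [← this, h2]
      exact e₀₁.src_eq
    have h1' : C.δ 0 (C.δ 1 z) = x₂ := by
      have : C.δ 0 (C.δ 1 z) = C.δ 0 (C.δ 0 z) := C.δ_castPred_δ 0 1 (by decide) z
      rw [this, h0]
      exact e₁₂.tgt_eq
    exact ⟨⟨(Edge.mk (C.δ 1 z) h1 h1').toTruncated, (Edge.CompStruct.mk (X := C)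
      (e₀₁ := .ofTruncated e₀₁) (e₁₂ := .ofTruncated e₁₂) z h2 h0 rfl).toTruncated⟩⟩
  fill31 {x₀ x₁ x₂ x₃ e₀₁ e₁₂ e₂₃ e₀₂ e₁₃ e₀₃} f₃ f₀ f₂ := by
    obtain ⟨z, hz⟩ := Quasicategory.exists_filler (C := C) (n := 1) 1 (by decide) (by decide)
      ![f₀.simplex, f₀.simplex, f₂.simplex, f₃.simplex] (by
        intro j k hj hk hjk
        have e02 : C.δ 1 f₀.simplex = C.δ 0 f₂.simplex := f₀.d₁.trans f₂.d₀.symm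
        have e03 : C.δ 2 f₀.simplex = C.δ 0 f₃.simplex := f₀.d₂.trans f₃.d₀.symm
        have e23 : C.δ 2 f₂.simplex = C.δ 2 f₃.simplex := f₂.d₂.trans f₃.d₂.symm
        fin_cases j <;> fin_cases k <;>
          first
          | exact (hj rfl).elim
          | exact (hk rfl).elim
          | exact (absurd hjk (by decide))
          | exact e02
          | exact e03
          | exact e23)
    have h0 : C.δ 0 z = f₀.simplex := hz 0 (by decide)
    have h2 : C.δ 2 z = f₂.simplex := hz 2 (by decide)
    have h3 : C.δ 3 z = f₃.simplex := hz 3 (by decide)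
    have g0 : C.δ 0 (C.δ 1 z) = C.δ 0 (C.δ 0 z) := C.δ_castPred_δ 0 1 (by decide) z
    have g1 : C.δ 1 (C.δ 2 z) = C.δ 1 (C.δ 1 z) := C.δ_castPred_δ 1 2 (by decide) z
    have g2 : C.δ 1 (C.δ 3 z) = C.δ 2 (C.δ 1 z) := C.δ_castPred_δ 1 3 (by decide) z
    rw [h0] at g0
    rw [h2] at g1
    rw [h3] at g2
    exact ⟨(Edge.CompStruct.mk (X := C) (e₀₁ := .ofTruncated e₀₂) (e₁₂ := .ofTruncated e₂₃)
      (e₀₂ := .ofTruncated e₀₃) (C.δ 1 z) (g2.symm.trans f₃.d₁) (g0.trans f₀.d₀)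
      (g1.symm.trans f₂.d₁)).toTruncated⟩
  fill32 {x₀ x₁ x₂ x₃ e₀₁ e₁₂ e₂₃ e₀₂ e₁₃ e₀₃} f₃ f₀ f₁ := by
    obtain ⟨z, hz⟩ := Quasicategory.exists_filler (C := C) (n := 1) 2 (by decide) (by decide)
      ![f₀.simplex, f₁.simplex, f₁.simplex, f₃.simplex] (by
        intro j k hj hk hjk
        have e01 : C.δ 0 f₀.simplex = C.δ 0 f₁.simplex := f₀.d₀.trans f₁.d₀.symm
        have e03 : C.δ 2 f₀.simplex = C.δ 0 f₃.simplex := f₀.d₂.trans f₃.d₀.symm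
        have e13 : C.δ 2 f₁.simplex = C.δ 1 f₃.simplex := f₁.d₂.trans f₃.d₁.symm
        fin_cases j <;> fin_cases k <;>
          first
          | exact (hj rfl).elim
          | exact (hk rfl).elim
          | exact (absurd hjk (by decide))
          | exact e01
          | exact e03
          | exact e13)
    have h0 : C.δ 0 z = f₀.simplex := hz 0 (by decide)
    have h1 : C.δ 1 z = f₁.simplex := hz 1 (by decide)
    have h3 : C.δ 3 z = f₃.simplex := hz 3 (by decide)
    have g0 : C.δ 0 (C.δ 2 z) = C.δ 1 (C.δ 0 z) := C.δ_castPred_δ 0 2 (by decide) z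
    have g1 : C.δ 1 (C.δ 2 z) = C.δ 1 (C.δ 1 z) := C.δ_castPred_δ 1 2 (by decide) z
    have g2 : C.δ 2 (C.δ 3 z) = C.δ 2 (C.δ 2 z) := C.δ_castPred_δ 2 3 (by decide) z
    rw [h0] at g0
    rw [h1] at g1
    rw [h3] at g2
    exact ⟨(Edge.CompStruct.mk (X := C) (e₀₁ := .ofTruncated e₀₁) (e₁₂ := .ofTruncated e₁₃)
      (e₀₂ := .ofTruncated e₀₃) (C.δ 2 z) (g2.symm.trans f₃.d₂) (g0.trans f₀.d₁)
      (g1.trans f₁.d₁)).toTruncated⟩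

open Truncated.HomotopyCategory₂ in
-- Every morphism of the homotopy category is the class of an edge, and every identity between
-- composites of such classes is witnessed by a $2$-simplex.
lemma Edge.isEquivalenceEdge_iff {C : SSet.{u}} [C.Quasicategory] {a b : C _⦋0⦌} (e : Edge a b) :
    C.IsEquivalenceEdge e.edge ↔ IsIso (homMk e.toTruncated) := by
  constructor
  · rintro ⟨I⟩
    let J : e.InvStruct := I.ofEq rfl
    exact ⟨homMk J.inv.toTruncated, J.homInvId.toTruncated.homotopyCategory₂_fac,
      J.invHomId.toTruncated.homotopyCategory₂_fac⟩
  · rintro ⟨g, h1, h2⟩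
    obtain ⟨g, rfl⟩ := homMk_surjective g
    have I : e.InvStruct :=
      { inv := .ofTruncated g
        homInvId := .ofTruncated (.ofHomotopyCategory₂Fac h1)
        invHomId := .ofTruncated (.ofHomotopyCategory₂Fac h2) }
    exact ⟨I.ofEq rfl⟩

/-- Equivalences in a quasi-category have the 2-out-of-3 property. -/
lemma IsEquivalenceEdge.two_out_of_three {C : SSet.{u}} [C.Quasicategory] (s : C _⦋2⦌) (k : Fin 3)
    (h : ∀ j, j ≠ k → C.IsEquivalenceEdge (C.δ j s)) : C.IsEquivalenceEdge (C.δ k s) := by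
  obtain ⟨x₀, x₁, x₂, e₀₁, e₁₂, e₀₂, t, rfl⟩ := Edge.CompStruct.exists_of_simplex s
  have fac := t.toTruncated.homotopyCategory₂_fac
  have h0 : (0 ≠ k) → _ := h 0
  have h1 : (1 ≠ k) → _ := h 1
  have h2 : (2 ≠ k) → _ := h 2
  rw [t.d₀, Edge.isEquivalenceEdge_iff] at h0
  rw [t.d₁, Edge.isEquivalenceEdge_iff, ← fac] at h1
  rw [t.d₂, Edge.isEquivalenceEdge_iff] at h2
  fin_cases k
  · change C.IsEquivalenceEdge (C.δ 0 _)
    rw [t.d₀, Edge.isEquivalenceEdge_iff]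
    have := h1 (by decide)
    have := h2 (by decide)
    exact IsIso.of_isIso_comp_left (Truncated.HomotopyCategory₂.homMk e₀₁.toTruncated) _
  · change C.IsEquivalenceEdge (C.δ 1 _)
    rw [t.d₁, Edge.isEquivalenceEdge_iff, ← fac]
    have := h0 (by decide)
    have := h2 (by decide)
    infer_instance
  · change C.IsEquivalenceEdge (C.δ 2 _)
    rw [t.d₂, Edge.isEquivalenceEdge_iff]
    have := h1 (by decide)
    have := h0 (by decide)
    exact IsIso.of_isIso_comp_right _ (Truncated.HomotopyCategory₂.homMk e₁₂.toTruncated)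

/-! ### Thin edges, and $C^e$ as a weak complicial set -/

lemma isEquivalenceEdge_σ (C : SSet.{u}) (x : C _⦋0⦌) : C.IsEquivalenceEdge (C.σ 0 x) :=
  ⟨(Edge.InvStruct.invStructId x).ofEq rfl⟩

lemma isEquivalenceEdge_of_mem_degenerate {C : SSet.{u}} {s : C _⦋1⦌} (hs : s ∈ C.degenerate 1) :
    C.IsEquivalenceEdge s := by
  rw [degenerate_eq_iUnion_range_σ, Set.mem_iUnion] at hs
  obtain ⟨i, x, rfl⟩ := hs
  obtain rfl : i = 0 := Fin.ext (by omega)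
  exact isEquivalenceEdge_σ C x

lemma mem_equivStratified_thin_one {C : SSet.{u}} {s : C _⦋1⦌} :
    s ∈ C.equivStratified.thin 1 ↔ C.IsEquivalenceEdge s :=
  ⟨fun h ↦ h.elim isEquivalenceEdge_of_mem_degenerate id, Or.inr⟩

/-- A map into `C^e` is stratified as soon as it preserves thin `1`-simplices. -/
lemma isStratified_equivStratified {C : SSet.{u}} {X : StratifiedSSet.{u}} {f : X.sset ⟶ C}
    (hf : ∀ s ∈ X.thin 1, C.IsEquivalenceEdge (f.app _ s)) :
    StratifiedSSet.IsStratified X C.equivStratified f := by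
  rintro (_ | _ | m) s hs
  · rw [X.thin_zero] at hs
    exact hs.elim
  · exact mem_equivStratified_thin_one.2 (hf s hs)
  · exact Set.mem_univ _

/-- The edge contains `k` and has at most two of the at least three vertices, so it omits a vertex
other than `k`. -/
lemma mem_horn_of_nbhd {n : ℕ} {k : Fin (n + 3)} (s : Δ[n + 2] _⦋1⦌)
    (hs : StratifiedSSet.nbhd k ⊆ Set.range (stdSimplex.asOrderHom s)) :
    s ∈ Λ[n + 2, k].obj (op ⦋1⦌) := by
  rw [mem_horn_iff, Set.union_eq_left.2 (Set.singleton_subset_iff.2 (hs (Or.inr (Or.inl rfl))))]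
  intro h
  have := Fintype.card_le_of_surjective _ (Set.range_eq_univ.1 h)
  simp at this

lemma const_app_one {C : SSet.{u}} (X : SSet.{u}) (v : C _⦋0⦌) (s : X _⦋1⦌) :
    (const (X := X) v).app _ s = C.σ 0 v := by
  change C.map _ v = C.map _ v
  congr 3
  exact congrArg Quiver.Hom.op (Subsingleton.elim _ _)

/-- The horn $\Lambda[1,k]$ is the single vertex $k$. -/
lemma exists_const_of_horn_one {C : SSet.{u}} (k : Fin 2) (f : (Λ[1, k] : SSet.{u}) ⟶ C) :
    ∃ v : C _⦋0⦌, Λ[1, k].ι ≫ const v = f := by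
  have hk : (stdSimplex.obj₀Equiv.symm k : Δ[1] _⦋0⦌) ∈ Λ[1, k].obj (op ⦋0⦌) := by
    rw [mem_horn_iff_notMem_range]
    refine ⟨k.rev, by clear f; revert k; decide, ?_⟩
    rintro ⟨i, hi⟩
    change k = k.rev at hi
    revert hi
    clear f
    revert k
    decide
  refine ⟨f.app _ ⟨_, hk⟩, ?_⟩
  ext ⟨d⟩ ⟨s, hs⟩
  induction d using SimplexCategory.rec with | _ d
  have hs' := hs
  rw [mem_horn_iff_notMem_range] at hs'
  obtain ⟨j, hj, hjs⟩ := hs'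
  refine (NatTrans.naturality_apply f (SimplexCategory.const ⦋d⦌ ⦋0⦌ 0).op ⟨_, hk⟩).symm.trans
    (congrArg (f.app (op ⦋d⦌)) ?_)
  refine Subtype.ext (stdSimplex.ext _ _ fun i ↦ ?_)
  have : s i ≠ j := fun h ↦ hjs ⟨i, h⟩
  change k = s i
  generalize s i = a at this
  omega

/-- For inner `k` no thinness is needed. For `k` first or last, `nbhd k` consists of two vertices,
which span the edge required by Joyal's theorem. -/
lemma exists_extension_complicialHorn {C : SSet.{u}} [C.Quasicategory] (n : ℕ) (k : Fin (n + 3))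
    (f : (Λ[n + 2, k] : SSet.{u}) ⟶ C)
    (hf : ∀ s : (Λ[n + 2, k] : SSet.{u}) _⦋1⦌,
      StratifiedSSet.nbhd k ⊆ Set.range (stdSimplex.asOrderHom s.1) →
        C.IsEquivalenceEdge (f.app _ s)) :
    ∃ g : Δ[n + 2] ⟶ C, Λ[n + 2, k].ι ≫ g = f := by
  by_cases h0 : k = 0
  · subst h0
    refine Quasicategory.exists_extension_horn_zero n f (hf _ ?_)
    rintro i (hi | hi | hi)
    · simp at hi
    · exact ⟨0, hi.symm⟩
    · exact ⟨1, Fin.ext hi.symm⟩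
  by_cases hl : k = Fin.last _
  · subst hl
    obtain ⟨y, hy, hfy⟩ := exists_isHornFamily f
    obtain ⟨z, hz⟩ := Quasicategory.exists_filler_last y hy (by
      rw [← hfy 0 (Fin.last_pos.ne), ← NatTrans.naturality_apply]
      apply hf
      rintro i (hi | hi | hi)
      · refine ⟨0, Fin.ext ?_⟩
        change n + 1 = i.val
        simpa using hi.symm
      · refine ⟨1, Fin.ext ?_⟩
        rw [hi]
        rfl
      · have := i.isLt
        simp only [Fin.val_last] at hi
        omega)
    exact ⟨_, exists_extension_of_filler f z fun j hj ↦ (hz j hj).trans (hfy j hj).symm⟩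
  · obtain ⟨g, hg⟩ := Quasicategory.hornFilling (Fin.pos_iff_ne_zero.2 h0)
      (Fin.lt_last_iff_ne_last.2 hl) f
    exact ⟨g, hg.symm⟩

lemma isEquivalenceEdge_app_of_horn {C : SSet.{u}} [C.Quasicategory] (k : Fin 3) (g : Δ[2] ⟶ C)
    (hg : ∀ s ∈ Λ[2, k].obj (op ⦋1⦌), C.IsEquivalenceEdge (g.app _ s)) (s : Δ[2] _⦋1⦌) :
    C.IsEquivalenceEdge (g.app _ s) := by
  by_cases hs : s ∈ Λ[2, k].obj (op ⦋1⦌)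
  · exact hg s hs
  -- The only edge outside the horn is the one opposite `k`.
  · have e : s = stdSimplex.objEquiv.symm (SimplexCategory.δ k) := by
      rw [mem_horn_iff_notMem_range] at hs
      push Not at hs
      have h01 : s 0 ≤ s 1 := stdSimplex.monotone_apply s (Fin.zero_le _)
      have key : ∀ (k a b : Fin 3), a ≤ b → (∀ j, j ≠ k → a = j ∨ b = j) →
        a = k.succAbove 0 ∧ b = k.succAbove 1 := by decide
      obtain ⟨h0, h1⟩ := key k (s 0) (s 1) h01 (fun j hj ↦ by
        obtain ⟨i, hi⟩ := hs j hj
        fin_cases i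
        · exact Or.inl hi
        · exact Or.inr hi)
      refine stdSimplex.ext _ _ fun i ↦ ?_
      fin_cases i
      · exact h0
      · exact h1
    have hd : ∀ j, C.δ j (yonedaEquiv g) =
        g.app _ (stdSimplex.objEquiv.symm (SimplexCategory.δ j)) :=
      fun j ↦ (stdSimplex.yonedaEquiv_δ_comp g j).symm
    rw [e, ← hd]
    refine IsEquivalenceEdge.two_out_of_three _ _ fun j hj ↦ ?_
    rw [hd]
    exact hg _ ((objEquiv_symm_δ_mem_horn_iff j k).2 hj)

/-- The stratified simplicial set `C^e` of a quasi-category `C` is a weak complicial set. -/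
theorem isWeakComplicial_equivStratified (C : SSet.{u}) [C.Quasicategory] :
    C.equivStratified.IsWeakComplicial where
  horn
    | 0, k => fun f ↦ by
      obtain ⟨v, hv⟩ := exists_const_of_horn_one (C := C) k f.map
      refine ⟨⟨const v, isStratified_equivStratified fun s _ ↦ ?_⟩, hv⟩
      exact (const_app_one (C := C) Δ[1] v s).symm ▸ isEquivalenceEdge_σ C v
    | n + 1, k => fun f ↦ by
      have hf : ∀ s : (Λ[n + 2, k] : SSet.{u}) _⦋1⦌,
          StratifiedSSet.nbhd k ⊆ Set.range (stdSimplex.asOrderHom s.1) →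
            C.IsEquivalenceEdge (f.map.app _ s) := fun s hs ↦
        mem_equivStratified_thin_one.1 (f.isStratified 1 s (Or.inr hs))
      obtain ⟨g, hg⟩ := exists_extension_complicialHorn (C := C) n k f.map hf
      refine ⟨⟨g, isStratified_equivStratified ?_⟩, hg⟩
      rintro s (hs | hs)
      · exact isEquivalenceEdge_of_mem_degenerate (degenerate_app_apply hs g)
      · have h := hf ⟨s, mem_horn_of_nbhd s hs⟩ hs
        rw [← hg] at h
        exact h
  thin n k f := by
    refine ⟨⟨f.map, isStratified_equivStratified ?_⟩, rfl⟩
    rintro s (hs | hs)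
    · exact mem_equivStratified_thin_one.1 (f.isStratified 1 s (Or.inl hs))
    · obtain rfl : n = 0 := by
        have : 1 = n + 1 := hs
        omega
      exact isEquivalenceEdge_app_of_horn (C := C) k f.map (fun s hs ↦
        mem_equivStratified_thin_one.1 (f.isStratified 1 s (Or.inr ⟨rfl, hs⟩))) s

end SSet

/-! ### Groups from composition relations -/

/-- A ternary relation `Q a b c`, to be thought of as `b = a * c` up to homotopy. -/
structure IsCompositionRelation {S : Type*} (e : S) (Q : S → S → S → Prop) : Prop where
  mul_one (a : S) : Q a a e
  one_mul (a : S) : Q e a a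
  exists_left (b c : S) : ∃ a, Q a b c
  exists_mul (a c : S) : ∃ b, Q a b c
  tetra₀ {a b c d f g : S} : Q a d f → Q b d g → Q c f g → Q a b c
  tetra₁ {a b c d f g : S} : Q a b c → Q b d g → Q c f g → Q a d f
  tetra₂ {a b c d f g : S} : Q a b c → Q a d f → Q c f g → Q b d g
  tetra₃ {a b c d f g : S} : Q a b c → Q a d f → Q b d g → Q c f g

namespace IsCompositionRelation

variable {S : Type*} {e : S} {Q : S → S → S → Prop} (h : IsCompositionRelation e Q)

include h

lemma equivalence : Equivalence (fun a b ↦ Q a b e) where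
  refl := h.mul_one
  symm {_ _} hab := h.tetra₂ hab (h.mul_one _) (h.mul_one e)
  trans {_ _ _} hab hbc := h.tetra₁ hab hbc (h.mul_one e)

/-- Multiplying by the unit on the right and on the left gives the same relation up to a swap. This
is what moves `Adj` from one position to the next. -/
lemma rel_iff (a b : S) : Q a b e ↔ Q e b a :=
  ⟨fun hab ↦ h.tetra₀ (h.one_mul b) (h.mul_one b) hab,
    fun hba ↦ h.tetra₃ hba (h.one_mul b) (h.mul_one b)⟩

lemma congr_left {a a' b c : S} (ha : Q a a' e) (hQ : Q a b c) : Q a' b c :=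
  h.tetra₂ ha hQ (h.one_mul c)

lemma congr_right {a b c c' : S} (hc : Q c c' e) (hQ : Q a b c) : Q a b c' :=
  h.tetra₁ hQ (h.mul_one b) hc

lemma mul_unique {a b b' c : S} (hb : Q a b c) (hb' : Q a b' c) : Q b b' e :=
  h.tetra₂ hb hb' (h.mul_one c)

theorem exists_group {R : S → S → Prop} (hR : ∀ a b, R a b ↔ Q a b e) :
    ∃ G : Group (Quot R), G.one = Quot.mk R e ∧
      ∀ a b c, Q a b c → G.mul (Quot.mk R a) (Quot.mk R c) = Quot.mk R b := by
  obtain rfl : R = fun a b ↦ Q a b e := by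
    ext a b
    exact hR a b
  have ex : ∀ {a b : S}, Quot.mk (fun a b ↦ Q a b e) a = Quot.mk _ b → Q a b e := fun hab ↦
    h.equivalence.eqvGen_iff.1 (Quot.eqvGen_exact hab)
  choose m hm using h.exists_mul
  choose i hi using h.exists_left e
  let X := Quot (fun a b ↦ Q a b e)
  let mulX : Mul X := ⟨fun x y ↦ Quot.mk _ (m x.out y.out)⟩
  let oneX : One X := ⟨Quot.mk _ e⟩
  let invX : Inv X := ⟨fun x ↦ Quot.mk _ (i x.out)⟩
  have key : ∀ a b c, Q a b c →
      (Quot.mk _ a : X) * (Quot.mk _ c : X) = (Quot.mk _ b : X) := by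
    intro a b c hQ
    refine Quot.sound (h.mul_unique (hm _ _) ?_)
    exact h.congr_left (ex (Quot.out_eq _).symm) (h.congr_right (ex (Quot.out_eq _).symm) hQ)
  let G : Group X := Group.ofLeftAxioms
    (by
      rintro ⟨x⟩ ⟨y⟩ ⟨z⟩
      -- Associativity is one tetrahedron: three of its faces are the chosen products $xy$, $(xy)z$
      -- and $yz$.
      rw [key _ _ _ (hm x y), key _ _ _ (hm y z), key _ _ _ (hm (m x y) z)]
      exact (key _ _ _ (h.tetra₁ (hm x y) (hm (m x y) z) (hm y z))).symm)
    (by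
      rintro ⟨x⟩
      exact key _ _ _ (h.one_mul x))
    (by
      intro x
      have := key _ _ _ (hi x.out)
      rwa [Quot.out_eq] at this)
  exact ⟨G, rfl, key⟩

end IsCompositionRelation

/-! ### Simplices with constant boundary, and their fillers -/

namespace SSet

open Opposite

/-- The constant `d`-simplex at a vertex. -/
def constSimplex {C : SSet.{u}} (c : C _⦋0⦌) (d : ℕ) : C _⦋d⦌ :=
  C.map (SimplexCategory.const ⦋d⦌ ⦋0⦌ 0).op c

lemma map_constSimplex {C : SSet.{u}} (c : C _⦋0⦌) {d e : ℕ} (f : ⦋e⦌ ⟶ ⦋d⦌) :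
    C.map f.op (constSimplex c d) = constSimplex c e :=
  (ConcreteCategory.congr_hom (C.map_comp (SimplexCategory.const ⦋d⦌ ⦋0⦌ 0).op f.op) c).symm

lemma δ_constSimplex {C : SSet.{u}} (c : C _⦋0⦌) {d : ℕ} (i : Fin (d + 2)) :
    C.δ i (constSimplex c (d + 1)) = constSimplex c d :=
  map_constSimplex c _

lemma σ_constSimplex {C : SSet.{u}} (c : C _⦋0⦌) {d : ℕ} (i : Fin (d + 1)) :
    C.σ i (constSimplex c d) = constSimplex c (d + 1) :=
  map_constSimplex c _

lemma isEquivalenceEdge_constSimplex {C : SSet.{u}} (c : C _⦋0⦌) :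
    C.IsEquivalenceEdge (constSimplex c 1) := by
  rw [← σ_constSimplex c 0]
  exact isEquivalenceEdge_σ C _

/-- All edges of the simplex `z` are degenerate at `c`. -/
def HasConstEdges {C : SSet.{u}} (c : C _⦋0⦌) {d : ℕ} (z : C _⦋d⦌) : Prop :=
  ∀ f : ⦋1⦌ ⟶ ⦋d⦌, C.map f.op z = constSimplex c 1

lemma hasConstEdges_constSimplex {C : SSet.{u}} (c : C _⦋0⦌) (d : ℕ) :
    HasConstEdges c (constSimplex c d) :=
  fun f ↦ map_constSimplex c f

lemma hasConstEdges_of_δ {C : SSet.{u}} {c : C _⦋0⦌} {d : ℕ} {z : C _⦋d + 2⦌}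
    (hz : ∀ i, HasConstEdges c (C.δ i z)) : HasConstEdges c z := by
  intro f
  obtain ⟨i, g, rfl⟩ := SimplexCategory.eq_comp_δ_of_not_surjective f (fun hf ↦ by
    have := Fintype.card_le_of_surjective _ hf
    simp at this)
  rw [op_comp, Functor.map_comp_apply]
  exact hz i g

/-- In an outer horn the edge that has to be an equivalence is constant, so Joyal's theorem applies.
-/
lemma Quasicategory.exists_filler_of_hasConstEdges {C : SSet.{u}} [C.Quasicategory] {c : C _⦋0⦌}
    {n : ℕ} (i : Fin (n + 3)) (y : Fin (n + 3) → C _⦋n + 1⦌) (hy : C.IsHornFamily i y)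
    (hc : ∀ j, j ≠ i → HasConstEdges c (y j)) :
    ∃ z : C _⦋n + 2⦌, ∀ j, j ≠ i → C.δ j z = y j := by
  by_cases h0 : i = 0
  · subst h0
    refine exists_filler_zero y hy ?_
    rw [hc _ Fin.last_pos.ne']
    exact isEquivalenceEdge_constSimplex c
  by_cases hl : i = Fin.last _
  · subst hl
    refine exists_filler_last y hy ?_
    rw [hc _ Fin.last_pos.ne]
    exact isEquivalenceEdge_constSimplex c
  · exact exists_filler i (Fin.pos_iff_ne_zero.2 h0) (Fin.lt_last_iff_ne_last.2 hl) y hy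

lemma not_surjective_δ_comp_σ {d : ℕ} (i : Fin (d + 2)) (j : Fin (d + 1)) (h : i.val ≠ j.val)
    (h' : i.val ≠ j.val + 1) :
    ¬ Function.Surjective (SimplexCategory.δ i ≫ SimplexCategory.σ j) := by
  intro hs
  -- Away from $j$ and $j + 1$, the vertex $i$ is the only preimage of its image under $\sigma_j$,
  -- and $\delta_i$ omits it.
  obtain ⟨x, hx⟩ := hs (Fin.predAbove j i)
  change Fin.predAbove j (Fin.succAbove i x) = Fin.predAbove j i at hx
  have hp (y : Fin (d + 2)) : (Fin.predAbove j y).val =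
      if j.val < y.val then y.val - 1 else y.val := by
    simp only [Fin.predAbove, Fin.lt_def, Fin.val_castSucc]
    split_ifs <;> rfl
  have hsA : (Fin.succAbove i x).val = if x.val < i.val then x.val else x.val + 1 := by
    simp only [Fin.succAbove, Fin.lt_def, Fin.val_castSucc]
    split_ifs <;> rfl
  rw [Fin.ext_iff, hp, hp, hsA] at hx
  split_ifs at hx <;> omega

/-- The `(d + 1)`-simplices all of whose faces are constant at `c`. -/
@[ext]
structure SphereSimplex {C : SSet.{u}} (c : C _⦋0⦌) (d : ℕ) : Type u where
  /-- the simplex -/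
  val : C _⦋d + 1⦌
  δ_val : ∀ i, C.δ i val = constSimplex c d

namespace SphereSimplex

variable {C : SSet.{u}} {c : C _⦋0⦌} {d : ℕ}

variable (c d) in
/-- The constant sphere. -/
def const : SphereSimplex c d := ⟨constSimplex c (d + 1), δ_constSimplex c⟩

/-- The index `d + 1` means dimension at least $2$, so every edge lies in a face. This is where $n
\ge 2$ enters. -/
lemma hasConstEdges (a : SphereSimplex c (d + 1)) : HasConstEdges c a.1 :=
  hasConstEdges_of_δ fun i ↦ by
    rw [a.2 i]
    exact hasConstEdges_constSimplex c _

lemma map_eq_constSimplex (a : SphereSimplex c d) {e : ℕ} (f : ⦋e⦌ ⟶ ⦋d + 1⦌)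
    (hf : ¬ Function.Surjective f) : C.map f.op a.1 = constSimplex c e := by
  obtain ⟨i, g, rfl⟩ := SimplexCategory.eq_comp_δ_of_not_surjective f hf
  rw [op_comp, Functor.map_comp_apply]
  exact (congrArg (C.map g.op) (a.2 i)).trans (map_constSimplex c g)

lemma δ_σ_self (a : SphereSimplex c d) (i : Fin (d + 3)) (j : Fin (d + 2)) :
    C.δ i (C.σ j a.1) = if i.val = j.val ∨ i.val = j.val + 1 then a.1 else constSimplex c _ := by
  split_ifs with h
  · rcases h with h | h
    · obtain rfl : i = j.castSucc := Fin.ext h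
      exact C.δ_comp_σ_self_apply j _
    · obtain rfl : i = j.succ := Fin.ext h
      exact C.δ_comp_σ_succ_apply j _
  · rw [not_or] at h
    exact (ConcreteCategory.congr_hom (C.map_comp (SimplexCategory.σ j).op
      (SimplexCategory.δ i).op) a.1).symm.trans (a.map_eq_constSimplex
        (SimplexCategory.δ i ≫ SimplexCategory.σ j) (not_surjective_δ_comp_σ i j h.1 h.2))

/-- Some `(d + 2)`-simplex has the faces `t`. -/
def IsBoundary (c : C _⦋0⦌) (t : ℕ → SphereSimplex c d) : Prop :=
  ∃ z : C _⦋d + 2⦌, ∀ i : Fin (d + 3), C.δ i z = (t i).1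

/-- Spheres always form a compatible horn, all their faces being the same constant, and the
simplicial identities make the new face a sphere. Quantifying over `s` lets the missing entry be
replaced without modifying `t`. -/
lemma exists_isBoundary [C.Quasicategory] (p : ℕ) (hp : p < d + 4)
    (t : ℕ → SphereSimplex c (d + 1)) :
    ∃ a, ∀ s : ℕ → SphereSimplex c (d + 1), s p = a → (∀ i, i ≠ p → s i = t i) →
      IsBoundary c s := by
  obtain ⟨z, hz⟩ := Quasicategory.exists_filler_of_hasConstEdges (c := c) ⟨p, hp⟩
    (fun i ↦ (t i).1) (fun j k hj hk hjk ↦ by rw [(t _).2, (t _).2]) (fun j _ ↦ (t j).hasConstEdges)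
  refine ⟨⟨C.δ ⟨p, hp⟩ z, fun i ↦ ?_⟩, fun s hs hs' ↦ ⟨z, fun i ↦ ?_⟩⟩
  · by_cases hi : i.castSucc < ⟨p, hp⟩
    · have := C.δ_castPred_δ i.castSucc ⟨p, hp⟩ hi z
      rw [hz _ hi.ne, (t _).2] at this
      exact this
    · have hi' : (⟨p, hp⟩ : Fin (d + 4)) < i.succ := Fin.lt_def.2 (by
        rw [Fin.lt_def] at hi; simp at hi ⊢; omega)
      have := C.δ_castPred_δ ⟨p, hp⟩ i.succ hi' z
      rw [hz _ hi'.ne', (t _).2] at this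
      exact this.symm
  · by_cases hi : i.val = p
    · obtain rfl : i = ⟨p, hp⟩ := Fin.ext hi
      exact (congrArg SphereSimplex.val hs).symm
    · rw [hs' _ hi]
      exact hz i (fun h ↦ hi (congrArg Fin.val h))

/-- The faces of the `k`-th face of a `(d + 3)`-simplex with `d`-codimensional faces `M j k`. -/
def pairFaces (M : ℕ → ℕ → SphereSimplex c d) (k i : ℕ) : SphereSimplex c d :=
  if i < k then M i k else M k (i + 1)

/-- Simplices chosen for the faces other than `p` agree on the common faces `M j k`, so they form a
horn with constant edges; the `p`-th face of its filler has the required boundary. -/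
lemma isBoundary_of_ne [C.Quasicategory] (M : ℕ → ℕ → SphereSimplex c (d + 1)) (p : ℕ)
    (hp : p < d + 5) (h : ∀ k < d + 5, k ≠ p → IsBoundary c (pairFaces M k)) :
    IsBoundary c (pairFaces M p) := by
  have h' : ∀ k : Fin (d + 5), ∃ z : C _⦋d + 3⦌, k ≠ ⟨p, hp⟩ →
      ∀ i : Fin (d + 4), C.δ i z = (pairFaces M k i).1 := by
    intro k
    by_cases hk : k = ⟨p, hp⟩
    · exact ⟨constSimplex c _, fun h ↦ (h hk).elim⟩
    · obtain ⟨z, hz⟩ := h k k.2 (fun h ↦ hk (Fin.ext h))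
      exact ⟨z, fun _ ↦ hz⟩
  choose y hy using h'
  have hlt : ∀ (j k : Fin (d + 5)) (hjk : j < k), j ≠ ⟨p, hp⟩ →
      C.δ (k.pred (Fin.ne_zero_of_lt hjk)) (y j) = (M j k).1 := by
    intro j k hjk hj
    rw [hy j hj, pairFaces, if_neg]
    · rw [Fin.val_pred, Nat.sub_add_cancel]
      have := Fin.lt_def.1 hjk
      omega
    · rw [Fin.val_pred]
      have := Fin.lt_def.1 hjk
      omega
  have hgt : ∀ (j k : Fin (d + 5)) (hjk : j < k), k ≠ ⟨p, hp⟩ →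
      C.δ (j.castPred (Fin.ne_last_of_lt hjk)) (y k) = (M j k).1 := by
    intro j k hjk hk
    rw [hy k hk, pairFaces, if_pos]
    · rfl
    · exact hjk
  obtain ⟨z, hz⟩ := Quasicategory.exists_filler_of_hasConstEdges (c := c) ⟨p, hp⟩ y
    (fun j k hj hk hjk ↦ by rw [hlt j k hjk hj, hgt j k hjk hk])
    (fun j hj ↦ hasConstEdges_of_δ fun i ↦ by
      rw [hy j hj]
      exact hasConstEdges _)
  refine ⟨C.δ ⟨p, hp⟩ z, fun i ↦ ?_⟩
  by_cases hi : i.castSucc < ⟨p, hp⟩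
  · have := C.δ_castPred_δ i.castSucc ⟨p, hp⟩ hi z
    rw [hz _ hi.ne, hlt _ _ hi hi.ne] at this
    rw [pairFaces, if_pos (show i.val < p from hi)]
    exact this
  · have hi' : (⟨p, hp⟩ : Fin (d + 5)) < i.succ := Fin.lt_def.2 (by
      rw [Fin.lt_def] at hi; simp at hi ⊢; omega)
    have := C.δ_castPred_δ ⟨p, hp⟩ i.succ hi' z
    rw [hz _ hi'.ne', hgt _ _ hi' hi'.ne'] at this
    rw [pairFaces, if_neg (show ¬ i.val < p from hi)]
    exact this.symm

/-! ### The triangle relation and its tetrahedra -/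

/-- The faces `a, b, c'` in positions `p`, `p + 1` and `p + 2`, and constant faces elsewhere. -/
def triFaces (p : ℕ) (a b c' : SphereSimplex c d) (i : ℕ) : SphereSimplex c d :=
  if i = p then a else if i = p + 1 then b else if i = p + 2 then c' else const c d

/-- A `(d + 2)`-simplex relates `a`, `b`, `c'` in positions `p`, `p + 1` and `p + 2`. -/
def Tri (p : ℕ) (a b c' : SphereSimplex c d) : Prop := IsBoundary c (triFaces p a b c')

/-- A `(d + 2)`-simplex relates `a` and `b` in positions `p` and `p + 1`. -/
def Adj (p : ℕ) (a b : SphereSimplex c d) : Prop :=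
  IsBoundary c (fun i ↦ if i = p then a else if i = p + 1 then b else const c d)

lemma tri_const_right (p : ℕ) (a b : SphereSimplex c d) : Tri p a b (const c d) ↔ Adj p a b := by
  apply iff_of_eq
  refine congrArg (IsBoundary c) (funext fun i ↦ ?_)
  simp only [triFaces, ite_self]

lemma tri_const_left (p : ℕ) (a b : SphereSimplex c d) :
    Tri p (const c d) a b ↔ Adj (p + 1) a b := by
  apply iff_of_eq
  refine congrArg (IsBoundary c) (funext fun i ↦ ?_)
  simp only [triFaces]
  split_ifs <;> first | rfl | omega

lemma adj_refl (p : ℕ) (hp : p < d + 2) (a : SphereSimplex c d) : Adj p a a := by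
  refine ⟨C.σ ⟨p, hp⟩ a.1, fun i ↦ ?_⟩
  rw [a.δ_σ_self]
  dsimp only
  split_ifs <;> first | rfl | omega

/-- The faces of codimension `2` of a `(d + 3)`-simplex with six faces in the positions in
`{p, p + 1, p + 2, p + 3}`, and constant faces elsewhere. -/
def tetraFaces (p : ℕ) (a b c' x y z : SphereSimplex c d) (j k : ℕ) : SphereSimplex c d :=
  if j = p then triFaces (p + 1) a b c' k
  else if j = p + 1 then triFaces (p + 2) x y (const c d) k
  else if j = p + 2 then if k = p + 3 then z else const c d
  else const c d

lemma isBoundary_pairFaces_tetraFaces (p : ℕ) (a b c' x y z : SphereSimplex c d) :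
    (IsBoundary c (pairFaces (tetraFaces p a b c' x y z) p) ↔ Tri p a b c') ∧
    (IsBoundary c (pairFaces (tetraFaces p a b c' x y z) (p + 1)) ↔ Tri p a x y) ∧
    (IsBoundary c (pairFaces (tetraFaces p a b c' x y z) (p + 2)) ↔ Tri p b x z) ∧
    (IsBoundary c (pairFaces (tetraFaces p a b c' x y z) (p + 3)) ↔ Tri p c' y z) ∧
    ∀ k, k ≠ p → k ≠ p + 1 → k ≠ p + 2 → k ≠ p + 3 →
      IsBoundary c (pairFaces (tetraFaces p a b c' x y z) k) := by
  refine ⟨?_, ?_, ?_, ?_, fun k h0 h1 h2 h3 ↦ ⟨constSimplex c _, fun i ↦ ?_⟩⟩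
  · refine iff_of_eq (congrArg (IsBoundary c) (funext fun i ↦ ?_))
    simp only [pairFaces, tetraFaces, triFaces]
    split_ifs <;> first | rfl | omega
  · refine iff_of_eq (congrArg (IsBoundary c) (funext fun i ↦ ?_))
    simp only [pairFaces, tetraFaces, triFaces]
    split_ifs <;> first | rfl | omega
  · refine iff_of_eq (congrArg (IsBoundary c) (funext fun i ↦ ?_))
    simp only [pairFaces, tetraFaces, triFaces]
    split_ifs <;> first | rfl | omega
  · refine iff_of_eq (congrArg (IsBoundary c) (funext fun i ↦ ?_))
    simp only [pairFaces, tetraFaces, triFaces]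
    split_ifs <;> first | rfl | omega
  · have : pairFaces (tetraFaces p a b c' x y z) k i = const c d := by
      simp only [pairFaces, tetraFaces, triFaces]
      split_ifs <;> rfl
    rw [this]
    exact δ_constSimplex c i

/-- Units are degenerate simplices, solvability is horn filling, and each tetrahedron rule is horn
filling one dimension higher. The bound on `p` makes `p + 3` a valid face position there. -/
lemma isCompositionRelation_tri [C.Quasicategory] (p : ℕ) (hp : p < d + 2) :
    IsCompositionRelation (const c (d + 1)) (Tri p) where
  mul_one a := (tri_const_right p a a).2 (adj_refl p (by omega) a)
  one_mul a := (tri_const_left p a a).2 (adj_refl (p + 1) (by omega) a)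
  exists_left b c' := by
    obtain ⟨a, ha⟩ := exists_isBoundary p (by omega) (triFaces p (const c _) b c')
    refine ⟨a, ha _ (if_pos rfl) fun i hi ↦ ?_⟩
    simp only [triFaces, if_neg hi]
  exists_mul a c' := by
    obtain ⟨b, hb⟩ := exists_isBoundary (p + 1) (by omega) (triFaces p a (const c _) c')
    refine ⟨b, hb _ ?_ fun i hi ↦ ?_⟩
    · simp [triFaces]
    · simp only [triFaces, if_neg hi]
  tetra₀ {a b c' x y z} h1 h2 h3 := by
    obtain ⟨e0, e1, e2, e3, e4⟩ := isBoundary_pairFaces_tetraFaces p a b c' x y z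
    refine e0.1 (isBoundary_of_ne _ _ (by omega) fun k _ hk ↦ ?_)
    by_cases hk1 : k = p + 1
    · exact hk1 ▸ e1.2 h1
    by_cases hk2 : k = p + 2
    · exact hk2 ▸ e2.2 h2
    by_cases hk3 : k = p + 3
    · exact hk3 ▸ e3.2 h3
    exact e4 k hk hk1 hk2 hk3
  tetra₁ {a b c' x y z} h0 h2 h3 := by
    obtain ⟨e0, e1, e2, e3, e4⟩ := isBoundary_pairFaces_tetraFaces p a b c' x y z
    refine e1.1 (isBoundary_of_ne _ _ (by omega) fun k _ hk ↦ ?_)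
    by_cases hk0 : k = p
    · exact hk0 ▸ e0.2 h0
    by_cases hk2 : k = p + 2
    · exact hk2 ▸ e2.2 h2
    by_cases hk3 : k = p + 3
    · exact hk3 ▸ e3.2 h3
    exact e4 k hk0 hk hk2 hk3
  tetra₂ {a b c' x y z} h0 h1 h3 := by
    obtain ⟨e0, e1, e2, e3, e4⟩ := isBoundary_pairFaces_tetraFaces p a b c' x y z
    refine e2.1 (isBoundary_of_ne _ _ (by omega) fun k _ hk ↦ ?_)
    by_cases hk0 : k = p
    · exact hk0 ▸ e0.2 h0
    by_cases hk1 : k = p + 1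
    · exact hk1 ▸ e1.2 h1
    by_cases hk3 : k = p + 3
    · exact hk3 ▸ e3.2 h3
    exact e4 k hk0 hk1 hk hk3
  tetra₃ {a b c' x y z} h0 h1 h2 := by
    obtain ⟨e0, e1, e2, e3, e4⟩ := isBoundary_pairFaces_tetraFaces p a b c' x y z
    refine e3.1 (isBoundary_of_ne _ _ (by omega) fun k _ hk ↦ ?_)
    by_cases hk0 : k = p
    · exact hk0 ▸ e0.2 h0
    by_cases hk1 : k = p + 1
    · exact hk1 ▸ e1.2 h1
    by_cases hk2 : k = p + 2
    · exact hk2 ▸ e2.2 h2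
    exact e4 k hk0 hk1 hk2 hk

lemma equivalence_adj [C.Quasicategory] (p : ℕ) (hp : p < d + 2) :
    Equivalence (Adj p : SphereSimplex c (d + 1) → SphereSimplex c (d + 1) → Prop) := by
  have := (isCompositionRelation_tri (c := c) p hp).equivalence
  simpa only [tri_const_right] using this

lemma adj_iff_adj_zero [C.Quasicategory] (p : ℕ) (hp : p < d + 3) (a b : SphereSimplex c (d + 1)) :
    Adj p a b ↔ Adj 0 a b := by
  induction p with
  | zero => rfl
  | succ p ih =>
    have h := (isCompositionRelation_tri (c := c) p (by omega : p < d + 2)).rel_iff b a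
    rw [tri_const_right, tri_const_left] at h
    rw [← ih (by omega), ← h]
    exact ⟨(equivalence_adj p (by omega)).symm, (equivalence_adj p (by omega)).symm⟩

end SphereSimplex

/-! ### Homotopies as maps out of a prism -/

/-- The simplex of `Δ[1]` whose first `j` vertices are `0` and whose other vertices are `1`. -/
def stepSimplex (d j : ℕ) : Δ[1] _⦋d⦌ :=
  stdSimplex.objMk ⟨fun i ↦ if i.val < j then 0 else 1, fun a b hab ↦ by
    have := Fin.le_def.1 hab
    dsimp only
    split_ifs <;> first | omega | simp⟩

lemma δ_stepSimplex_of_le {d j : ℕ} (i : Fin (d + 2)) (h : i.val ≤ j) :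
    (Δ[1] : SSet.{u}).δ i (stepSimplex (d + 1) (j + 1)) = stepSimplex d j := by
  refine stdSimplex.ext _ _ fun x ↦ ?_
  have hs : (Fin.succAbove i x).val = if x.val < i.val then x.val else x.val + 1 := by
    simp only [Fin.succAbove, Fin.lt_def, Fin.val_castSucc]
    split_ifs <;> rfl
  change (if (Fin.succAbove i x).val < j + 1 then (0 : Fin 2) else 1) = if x.val < j then 0 else 1
  rw [hs]
  split_ifs <;> first | rfl | omega

lemma δ_stepSimplex_of_ge {d j : ℕ} (i : Fin (d + 2)) (h : j ≤ i.val) :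
    (Δ[1] : SSet.{u}).δ i (stepSimplex (d + 1) j) = stepSimplex d j := by
  refine stdSimplex.ext _ _ fun x ↦ ?_
  have hs : (Fin.succAbove i x).val = if x.val < i.val then x.val else x.val + 1 := by
    simp only [Fin.succAbove, Fin.lt_def, Fin.val_castSucc]
    split_ifs <;> rfl
  change (if (Fin.succAbove i x).val < j then (0 : Fin 2) else 1) = if x.val < j then 0 else 1
  rw [hs]
  split_ifs <;> first | rfl | omega

/-- The tautological simplex of `Δ[n]`. -/
def idSimplex (n : ℕ) : Δ[n] _⦋n⦌ := stdSimplex.objEquiv.symm (𝟙 _)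

namespace SphereSimplex

variable {C : SSet.{u}} {c : C _⦋0⦌} {d : ℕ}

/-- A homotopy that is constant on the boundary gives a chain of adjacent spheres. -/
lemma exists_chain (H : Δ[d + 1] ⊗ Δ[1] ⟶ C)
    (hH : ∀ (e : ℕ) (x : Δ[d + 1] _⦋e⦌) (y : Δ[1] _⦋e⦌), x ∈ (boundary (d + 1)).obj (op ⦋e⦌) →
      H.app (op ⦋e⦌) (x, y) = constSimplex c e) :
    ∃ γ : ℕ → SphereSimplex c d,
      (∀ j, (γ j).val = H.app (op ⦋d + 1⦌) (idSimplex (d + 1), stepSimplex (d + 1) j)) ∧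
        ∀ j < d + 2, Adj j (γ j) (γ (j + 1)) := by
  have nat : ∀ {e : ℕ} (i : Fin (e + 2)) (x : Δ[d + 1] _⦋e + 1⦌) (y : Δ[1] _⦋e + 1⦌),
      C.δ i (H.app (op ⦋e + 1⦌) (x, y)) =
        H.app (op ⦋e⦌) ((Δ[d + 1] : SSet.{u}).δ i x, (Δ[1] : SSet.{u}).δ i y) := by
    intro e i x y
    let s : (Δ[d + 1] ⊗ Δ[1] : SSet.{u}) _⦋e + 1⦌ := (x, y)
    exact (NatTrans.naturality_apply H (SimplexCategory.δ i).op s).symm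
  let γ (j : ℕ) : SphereSimplex c d :=
    ⟨H.app (op ⦋d + 1⦌) (idSimplex (d + 1), stepSimplex (d + 1) j), fun i ↦ by
      rw [nat]
      refine hH _ _ _ ?_
      intro hs
      obtain ⟨x, hx⟩ := hs i
      exact Fin.succAbove_ne i x hx⟩
  -- The top simplices of the standard triangulation of the prism: the `j`-th has faces `γ j` and `γ
  -- (j + 1)` in positions `j` and `j + 1`, and its other faces lie over the boundary.
  refine ⟨γ, fun _ ↦ rfl, fun j hj ↦ ⟨H.app (op ⦋d + 2⦌)
    (stdSimplex.objEquiv.symm (SimplexCategory.σ ⟨j, hj⟩), stepSimplex (d + 2) (j + 1)),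
    fun i ↦ ?_⟩⟩
  rw [nat]
  have hδ : (Δ[d + 1] : SSet.{u}).δ i (stdSimplex.objEquiv.symm (SimplexCategory.σ ⟨j, hj⟩)) =
    stdSimplex.objEquiv.symm (SimplexCategory.δ i ≫ SimplexCategory.σ ⟨j, hj⟩) := rfl
  rw [hδ]
  dsimp only
  split_ifs with h1 h2
  · obtain rfl : i = Fin.castSucc ⟨j, hj⟩ := Fin.ext h1
    rw [SimplexCategory.δ_comp_σ_self]
    exact congrArg (fun y ↦ H.app (op ⦋d + 1⦌) (idSimplex (d + 1), y))
      (δ_stepSimplex_of_le _ le_rfl)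
  · obtain rfl : i = Fin.succ ⟨j, hj⟩ := Fin.ext h2
    rw [SimplexCategory.δ_comp_σ_succ]
    exact congrArg (fun y ↦ H.app (op ⦋d + 1⦌) (idSimplex (d + 1), y))
      (δ_stepSimplex_of_ge _ le_rfl)
  · exact hH _ _ _ (not_surjective_δ_comp_σ i ⟨j, hj⟩ h1 h2)

/-- The map `Δ[d] ⊗ Δ[1] ⟶ Δ[d + 1]` that on vertices is the last coface on `Δ[d] ⊗ {0}` and the
coface before it on `Δ[d] ⊗ {1}`. -/
def collapse (d : ℕ) : (Δ[d] ⊗ Δ[1] : SSet.{u}) ⟶ Δ[d + 1] where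
  app e := ↾fun s ↦ stdSimplex.objMk
    ⟨fun i ↦ if stdSimplex.asOrderHom s.1 i = Fin.last d ∧ stdSimplex.asOrderHom s.2 i = 1 then
        Fin.last (d + 1) else (stdSimplex.asOrderHom s.1 i).castSucc, fun a b hab ↦ by
      have h1 := (stdSimplex.asOrderHom s.1).monotone hab
      have h2 := (stdSimplex.asOrderHom s.2).monotone hab
      dsimp only
      split_ifs with ha hb hb
      · exact le_rfl
      · refine (hb ⟨?_, ?_⟩).elim
        · exact le_antisymm (Fin.le_last _) (ha.1 ▸ h1)
        · exact le_antisymm (Fin.le_last _) (ha.2 ▸ h2)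
      · exact Fin.le_last _
      · exact Fin.castSucc_le_castSucc_iff.2 h1⟩
  naturality _ _ _ := rfl

lemma collapse_apply {d e : ℕ} (x : Δ[d] _⦋e⦌) (y : Δ[1] _⦋e⦌) (i : Fin (e + 1)) :
    ((collapse.{u} d).app (op ⦋e⦌) (x, y) : Δ[d + 1] _⦋e⦌) i =
      if x i = Fin.last d ∧ y i = 1 then Fin.last (d + 1) else (x i).castSucc := rfl

lemma collapse_app_zero (d : ℕ) (y : Δ[1] _⦋d⦌) (hy : ∀ i, y i = 0) :
    (collapse.{u} d).app (op ⦋d⦌) (idSimplex d, y) =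
      stdSimplex.objEquiv.symm (SimplexCategory.δ (Fin.last (d + 1))) := by
  refine stdSimplex.ext _ _ fun i ↦ ?_
  rw [collapse_apply, if_neg (by rw [hy]; simp)]
  exact (Fin.succAbove_last_apply i).symm

lemma collapse_app_one (d : ℕ) (y : Δ[1] _⦋d⦌) (hy : ∀ i, y i = 1) :
    (collapse.{u} d).app (op ⦋d⦌) (idSimplex d, y) =
      stdSimplex.objEquiv.symm (SimplexCategory.δ (Fin.last d).castSucc) := by
  refine stdSimplex.ext _ _ fun i ↦ ?_
  rw [collapse_apply]
  change _ = Fin.succAbove (Fin.last d).castSucc i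
  by_cases h : i = Fin.last d
  · rw [if_pos ⟨h, hy i⟩, h, Fin.succAbove_castSucc_self, Fin.succ_last]
  · rw [if_neg fun h' ↦ h h'.1, Fin.succAbove_of_castSucc_lt _ _ (Fin.castSucc_lt_castSucc_iff.2
      (Fin.lt_last_iff_ne_last.2 h))]
    rfl

/-- If `x` omits the vertex `k`, so does its image under the collapse, which thus lies in the `k`-th
face of `z`. That face is constant unless `k` is last; then it is `b`, and the image lies in the
boundary of `b`. -/
lemma collapse_boundary {a b : SphereSimplex c d} (z : C _⦋d + 2⦌)
    (hz : ∀ i : Fin (d + 3), C.δ i z =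
      (if i.val = d + 1 then b else if i.val = d + 1 + 1 then a else const c d).1)
    {e : ℕ} (x : Δ[d + 1] _⦋e⦌) (y : Δ[1] _⦋e⦌) (hx : x ∈ (boundary (d + 1)).obj (op ⦋e⦌)) :
    (collapse (d + 1) ≫ yonedaEquiv.symm z).app (op ⦋e⦌) (x, y) = constSimplex c e := by
  rw [mem_boundary_iff_notMem_range] at hx
  obtain ⟨k, hk⟩ := hx
  obtain ⟨f, hf⟩ := stdSimplex.objEquiv.symm.surjective ((collapse (d + 1)).app (op ⦋e⦌) (x, y))
  have hf' : ∀ i, f i =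
      if x i = Fin.last (d + 1) ∧ y i = 1 then Fin.last (d + 2) else (x i).castSucc := fun i ↦
    congrArg (fun s : Δ[d + 2] _⦋e⦌ ↦ s i) hf
  have hfk : ∀ i, f i ≠ k.castSucc := fun i hi ↦ by
    rw [hf' i] at hi
    split_ifs at hi
    · exact (Fin.castSucc_lt_last k).ne' hi
    · exact hk ⟨i, Fin.castSucc_injective _ hi⟩
  change (yonedaEquiv.symm z).app _ ((collapse (d + 1)).app (op ⦋e⦌) (x, y)) = _
  rw [← hf]
  change C.map f.op z = _
  obtain ⟨g, rfl⟩ := SimplexCategory.eq_comp_δ_of_not_surjective' f k.castSucc hfk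
  rw [op_comp, Functor.map_comp_apply]
  change C.map g.op (C.δ k.castSucc z) = _
  rw [hz, Fin.val_castSucc]
  by_cases hkl : k = Fin.last (d + 1)
  · rw [if_pos (show k.val = d + 1 from congrArg Fin.val hkl)]
    refine b.map_eq_constSimplex g fun hg ↦ ?_
    obtain ⟨i, hi⟩ := hg (Fin.last (d + 1))
    have h3 : Fin.succAbove k.castSucc (g i) = _ := hf' i
    rw [show g i = Fin.last (d + 1) from hi, hkl, Fin.succAbove_castSucc_self] at h3
    split_ifs at h3 with h4
    · exact hk ⟨i, h4.1.trans hkl.symm⟩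
    · exact (Fin.castSucc_lt_last (x i)).ne h3.symm
  · have hkl' : k.val < d + 1 := Fin.lt_last_iff_ne_last.2 hkl
    rw [if_neg (show ¬ k.val = _ by omega), if_neg (show ¬ k.val = _ by omega)]
    exact map_constSimplex c g

end SphereSimplex

end SSet

lemma IsCompositionRelation.comap {S T : Type*} {e : S} {Q : S → S → S → Prop}
    (h : IsCompositionRelation e Q) (f : T → S) (hf : Function.Surjective f) (e' : T)
    (he : f e' = e) : IsCompositionRelation e' (fun a b c ↦ Q (f a) (f b) (f c)) where
  mul_one a := he ▸ h.mul_one (f a)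
  one_mul a := he ▸ h.one_mul (f a)
  exists_left b c := by
    obtain ⟨a, ha⟩ := h.exists_left (f b) (f c)
    obtain ⟨a, rfl⟩ := hf a
    exact ⟨a, ha⟩
  exists_mul a c := by
    obtain ⟨b, hb⟩ := h.exists_mul (f a) (f c)
    obtain ⟨b, rfl⟩ := hf b
    exact ⟨b, hb⟩
  tetra₀ := h.tetra₀
  tetra₁ := h.tetra₁
  tetra₂ := h.tetra₂
  tetra₃ := h.tetra₃

/-! ### Transport to the homotopy group of $C^e$ -/

namespace StratifiedSSet.Sphere

open Opposite SSet

variable {C : SSet.{u}} {c : C _⦋0⦌} {d : ℕ}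

/-- A map out of `Δ[n]` into `C`, as a map of simplicial sets. -/
abbrev toMap (α : Sphere C.equivStratified d c) : Δ[d] ⟶ C := α.map

lemma app_of_mem_boundary (α : Sphere C.equivStratified d c) {e : ℕ} (x : Δ[d] _⦋e⦌)
    (hx : x ∈ (SSet.boundary d).obj (op ⦋e⦌)) : α.toMap.app _ x = constSimplex c e :=
  ConcreteCategory.congr_hom (congr_app α.boundary (op ⦋e⦌)) ⟨x, hx⟩

/-- The simplex underlying a sphere. -/
def simplex (α : Sphere C.equivStratified (d + 1) c) : SphereSimplex c d where
  val := yonedaEquiv α.toMap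
  δ_val i := by
    rw [← stdSimplex.yonedaEquiv_δ_comp]
    exact α.app_of_mem_boundary _ (fun hs ↦ by
      obtain ⟨x, hx⟩ := hs i
      exact Fin.succAbove_ne i x hx)

lemma simplex_surjective : Function.Surjective
    (simplex : Sphere C.equivStratified (d + 1) c → SphereSimplex c d) := by
  intro a
  refine ⟨⟨yonedaEquiv.symm a.val, ?_⟩, SphereSimplex.ext (Equiv.apply_symm_apply _ _)⟩
  ext ⟨e⟩ ⟨x, hx⟩
  induction e using SimplexCategory.rec with | _ e
  exact a.map_eq_constSimplex (stdSimplex.objEquiv x) hx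

lemma simplex_const : (const : Sphere C.equivStratified (d + 1) c).simplex =
    SphereSimplex.const c d := rfl

/-- The chain starts at `β`, since the step simplex with no zeros is constant at $1$. All positions
of `Adj` are equivalent, so the chain composes. -/
lemma adj_of_rel [C.Quasicategory] {α β : Sphere C.equivStratified (d + 2) c} (h : Rel α β) :
    SphereSimplex.Adj 0 β.simplex α.simplex := by
  obtain ⟨H, h0, h1, hH⟩ := h
  obtain ⟨K, hK⟩ : ∃ K : Δ[d + 2] ⊗ Δ[1] ⟶ C, K = H.map := ⟨_, rfl⟩
  replace h0 : ι₀ ≫ K = α.toMap := by rw [hK]; exact h0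
  replace h1 : ι₁ ≫ K = β.toMap := by rw [hK]; exact h1
  replace hH : (SSet.boundary (d + 2)).ι ▷ Δ[1] ≫ K =
      fst _ _ ≫ (SSet.boundary (d + 2)).ι ≫ α.toMap := by
    rw [hK]; exact hH
  obtain ⟨γ, hγ, hadj⟩ := SphereSimplex.exists_chain (c := c) K (fun e x y hx ↦ by
    let s : ((SSet.boundary (d + 2) : SSet.{u}) ⊗ Δ[1]) _⦋e⦌ := (⟨x, hx⟩, y)
    have := ConcreteCategory.congr_hom (congr_app hH (op ⦋e⦌)) s
    exact this.trans (α.app_of_mem_boundary x hx))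
  have hchain : ∀ j ≤ d + 3, SphereSimplex.Adj 0 (γ 0) (γ j) := by
    intro j hj
    induction j with
    | zero => exact (SphereSimplex.equivalence_adj 0 (by omega)).refl _
    | succ j ih =>
      exact (SphereSimplex.equivalence_adj 0 (by omega)).trans (ih (by omega))
        ((SphereSimplex.adj_iff_adj_zero j (by omega) _ _).1 (hadj j (by omega)))
  have e0 : γ 0 = β.simplex := by
    refine SphereSimplex.ext ((hγ 0).trans ?_)
    change _ = yonedaEquiv β.toMap
    rw [← h1]
    refine congrArg (fun y ↦ K.app (op ⦋d + 2⦌) (idSimplex (d + 2), y)) ?_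
    exact SSet.stdSimplex.ext _ _ fun i ↦ rfl
  have e1 : γ (d + 3) = α.simplex := by
    refine SphereSimplex.ext ((hγ (d + 3)).trans ?_)
    change _ = yonedaEquiv α.toMap
    rw [← h0]
    refine congrArg (fun y ↦ K.app (op ⦋d + 2⦌) (idSimplex (d + 2), y)) ?_
    exact SSet.stdSimplex.ext _ _ fun i ↦ if_pos i.2
  have := hchain (d + 3) le_rfl
  rwa [e0, e1] at this

lemma rel_of_adj {α β : Sphere C.equivStratified (d + 2) c}
    (h : SphereSimplex.Adj (d + 2) β.simplex α.simplex) : Rel α β := by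
  obtain ⟨z, hz⟩ := h
  let K : Δ[d + 2] ⊗ Δ[1] ⟶ C := SphereSimplex.collapse (d + 2) ≫ SSet.yonedaEquiv.symm z
  have hbd : ∀ {e : ℕ} (x : Δ[d + 2] _⦋e⦌) (y : Δ[1] _⦋e⦌),
      x ∈ (SSet.boundary (d + 2)).obj (op ⦋e⦌) → K.app (op ⦋e⦌) (x, y) = constSimplex c e :=
    fun x y hx ↦ SphereSimplex.collapse_boundary z hz x y hx
  refine ⟨⟨K, isStratified_equivStratified ?_⟩, ?_, ?_, ?_⟩
  -- Every edge of $\Delta[d+2]$ lies in the boundary, so all edges of the prism go to the constant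
  -- edge and stratification is automatic.
  · rintro ⟨x, y⟩ -
    have hx : x ∈ (SSet.boundary (d + 2)).obj (op ⦋1⦌) := by
      rw [SSet.boundary_obj_eq_univ 1 (d + 2) (by omega)]
      exact Set.mem_univ _
    exact (hbd x y hx).symm ▸ isEquivalenceEdge_constSimplex c
  · refine SSet.yonedaEquiv.injective ?_
    refine (congrArg ((SSet.yonedaEquiv.symm z).app (op ⦋d + 2⦌))
      (SphereSimplex.collapse_app_zero (d + 2) _ fun i ↦ rfl)).trans ((hz (Fin.last _)).trans ?_)
    exact congrArg SphereSimplex.val ((if_neg (show ¬ d + 3 = d + 2 by omega)).trans (if_pos rfl))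
  · refine SSet.yonedaEquiv.injective ?_
    refine (congrArg ((SSet.yonedaEquiv.symm z).app (op ⦋d + 2⦌))
      (SphereSimplex.collapse_app_one (d + 2) _ fun i ↦ rfl)).trans
        ((hz (Fin.last _).castSucc).trans ?_)
    exact congrArg SphereSimplex.val (if_pos rfl)
  · ext ⟨e⟩ ⟨⟨x, hx⟩, y⟩
    induction e using SimplexCategory.rec with | _ e
    exact (hbd x y hx).trans (α.app_of_mem_boundary x hx).symm

/-- With $n = d + 2$ the faces $n-1, n, n+1$ are those of `Tri (d + 1)`, with the product in the
middle. The filler has only constant edges, so it is automatically stratified. -/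
lemma isProduct_iff (α β γ : Sphere C.equivStratified (d + 2) c) :
    IsProduct α β γ ↔ SphereSimplex.Tri (d + 1) α.simplex γ.simplex β.simplex := by
  constructor
  · rintro ⟨θ, hθ⟩
    refine ⟨SSet.yonedaEquiv (X := C) θ.map, fun i ↦ ?_⟩
    refine (SSet.stdSimplex.yonedaEquiv_δ_comp (X := C) θ.map i).symm.trans ?_
    obtain ⟨h1, h2, h3, h4⟩ := hθ i
    simp only [SphereSimplex.triFaces]
    split_ifs with h h' h''
    · exact congrArg SSet.yonedaEquiv (h2 (by omega))
    · exact congrArg SSet.yonedaEquiv (h3 (by omega))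
    · exact congrArg SSet.yonedaEquiv (h4 (by omega))
    · exact congrArg SSet.yonedaEquiv (h1 (by omega))
  · rintro ⟨z, hz⟩
    refine ⟨⟨yonedaEquiv.symm z, isStratified_equivStratified fun s _ ↦ ?_⟩, fun j ↦ ?_⟩
    · have : HasConstEdges c z := hasConstEdges_of_δ fun i ↦ by
        rw [hz]
        exact SphereSimplex.hasConstEdges _
      have := isEquivalenceEdge_constSimplex c
      rw [← ‹HasConstEdges c z› (stdSimplex.objEquiv s)] at this
      exact this
    · have key : ∀ (f : Δ[d + 2] ⟶ C), C.δ j z = yonedaEquiv f →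
          SSet.stdSimplex.δ j ≫ yonedaEquiv.symm z = f := fun f hf ↦ by
        apply SSet.yonedaEquiv.injective
        rw [SSet.stdSimplex.yonedaEquiv_δ_comp, Equiv.apply_symm_apply, hf]
      refine ⟨fun h ↦ key _ ?_, fun h ↦ key _ ?_, fun h ↦ key _ ?_, fun h ↦ key _ ?_⟩
      all_goals
        rw [hz, SphereSimplex.triFaces]
      · rw [if_neg (by omega), if_neg (by omega), if_neg (by omega)]
        rfl
      · rw [if_pos (by omega)]
        rfl
      · rw [if_neg (by omega), if_pos (by omega)]
        rfl
      · rw [if_neg (by omega), if_neg (by omega), if_pos (by omega)]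
        rfl

lemma rel_iff [C.Quasicategory] (α β : Sphere C.equivStratified (d + 2) c) :
    Rel α β ↔ SphereSimplex.Tri (d + 1) α.simplex β.simplex (SphereSimplex.const c (d + 1)) := by
  rw [SphereSimplex.tri_const_right, SphereSimplex.adj_iff_adj_zero _ (by omega)]
  have h0 := SphereSimplex.equivalence_adj (c := c) (d := d) 0 (by omega)
  exact ⟨fun h ↦ h0.symm (adj_of_rel h), fun h ↦ rel_of_adj
    ((SphereSimplex.adj_iff_adj_zero _ (by omega) _ _).2 (h0.symm h))⟩

end StratifiedSSet.Sphere

theorem mainTheorem4 (C : SSet.{u}) [C.Quasicategory] (c : C _⦋0⦌) (n : ℕ) (hn : 2 ≤ n) :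
    C.equivStratified.IsWeakComplicial ∧
    _root_.Equivalence (StratifiedSSet.Sphere.Rel (X := C.equivStratified) (n := n) (x := c)) ∧
    (∀ α β : StratifiedSSet.Sphere C.equivStratified n c,
      ∃ γ : StratifiedSSet.Sphere C.equivStratified n c, α.IsProduct β γ) ∧
    ∃ G : Group (StratifiedSSet.HomotopyMonoid C.equivStratified n c),
      StratifiedSSet.IsHomotopyMonoidStructure G.toMonoid := by
  obtain ⟨d, rfl⟩ := Nat.exists_eq_add_of_le' hn
  have h := (SSet.SphereSimplex.isCompositionRelation_tri (c := c) (d := d) (d + 1)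
    (by omega)).comap StratifiedSSet.Sphere.simplex StratifiedSSet.Sphere.simplex_surjective _
    StratifiedSSet.Sphere.simplex_const
  have hR (α β : StratifiedSSet.Sphere C.equivStratified (d + 2) c) :=
    StratifiedSSet.Sphere.rel_iff α β
  refine ⟨SSet.isWeakComplicial_equivStratified C, ?_, fun α β ↦ ?_, ?_⟩
  · convert h.equivalence using 3
    exact hR _ _
  · obtain ⟨γ, hγ⟩ := h.exists_mul α β
    exact ⟨γ, (StratifiedSSet.Sphere.isProduct_iff α β γ).2 hγ⟩
  · obtain ⟨G, hG1, hG⟩ := h.exists_group hR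
    exact ⟨G, fun α β γ hp ↦ hG _ _ _ ((StratifiedSSet.Sphere.isProduct_iff α β γ).1 hp), hG1⟩
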